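/- Let $P_\nu^\mu(z)$ be Hobson's associated Legendre function of the first kind, defined for $\nu,\mu\in\mathbb{C}$ and $z\in\mathbb{C}\setminus(-\infty,1]$ by $$P_\nu^\mu(z)=\left(\frac{z+1}{z-1}\right)^{\mu/2}\frac{1}{\Gamma(1-\mu)}\,{}_2F_1\!\left(-\nu,\nu+1;1-\mu;\frac{1-z}{2}\right),$$ where ${}_2F_1(a,b;c;w)/\Gamma(c)$ denotes the analytic continuation to $w\in\mathbb{C}\setminus[1,\infty)$ of the sum $\sum_{k\ge0}\frac{(a)_k(b)_k}{\Gamma(c+k)\,k!}w^k$ (with $1/\Gamma=0$ at the poles of $\Gamma$). All powers and logarithms of $z\pm1$ are determined by $-\pi<\arg(z\pm1)<\pi$; in particular $\left(\frac{z^2-1}{4}\right)^{m/2}=2^{-m}(z-1)^{m/2}(z+1)^{m/2}$ and $\left(\frac{z-1}{z+1}\right)^{m/2}=(z-1)^{m/2}(z+1)^{-m/2}$. Let $\psi=\Gamma'/\Gamma$ be the digamma function. Let $m,n$ be integers with $0\le m\le n$ and let $z\in\mathbb{C}\setminus(-\infty,1]$. Then $\nu\mapsto P_\nu^m(z)$ is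 complex differentiable at $\nu=n$ and $$\begin{aligned}\frac{\partial P_\nu^m(z)}{\partial\nu}\bigg|_{\nu=n}={}&P_n^m(z)\ln\frac{z+1}{2}-[\psi(n+m+1)+\psi(n-m+1)]P_n^m(z)\\&+\left(\frac{z^2-1}{4}\right)^{m/2}\sum_{k=0}^{n-m}\frac{(k+n+m)!}{k!\,(k+m)!\,(n-m-k)!}\,[2\psi(k+n+m+1)-\psi(k+m+1)]\left(\frac{z-1}{2}\right)^k\\&+\frac{(n+m)!}{(n-m)!}\left(\frac{z-1}{z+1}\right)^{m/2}\sum_{k=0}^{n}\frac{(k+n)!\,\psi(k+m+1)}{k!\,(k+m)!\,(n-k)!}\left(\frac{z-1}{2}\right)^k.\end{aligned}$$ For $m=0$, writing $P_\nu=P_\nu^0$, this reduces to Schelkunoff's formula $$\frac{\partial P_\nu(z)}{\partial\nu}\bigg|_{\nu=n}=P_n(z)\ln\frac{z+1}{2}-2\psi(n+1)P_n(z)+2\sum_{k=0}^{n}\frac{(k+n)!\,\psi(k+n+1)}{(k!)^2\,(n-k)!}\left(\frac{z-1}{2}\right)^k.$$ -/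

import Mathlib

open Complex

/-- `f` is a single-valued analytic continuation, to the plane cut along `[1, ∞)`, of the
regularized Gauss hypergeometric series `∑ₖ (a)ₖ (b)ₖ / (Γ(c + k) k!) wᵏ`. -/
def IsGaussContinuation (a b c : ℂ) (f : ℂ → ℂ) : Prop :=
  DifferentiableOn ℂ f {w | 1 - w ∈ slitPlane} ∧
    ∀ w ∈ Metric.ball (0 : ℂ) 1, f w = regularizedGaussHGFun a b c w

/-- The analytic continuation is unique on the cut plane. -/
theorem IsGaussContinuation.eqOn {a b c : ℂ} {f g : ℂ → ℂ}
    (hf : IsGaussContinuation a b c f) (hg : IsGaussContinuation a b c g) :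
    Set.EqOn f g {w | 1 - w ∈ slitPlane} := by
  have hcont : Continuous fun w : ℂ => 1 - w := by fun_prop
  have hopen : IsOpen {w : ℂ | 1 - w ∈ slitPlane} := isOpen_slitPlane.preimage hcont
  have himg : {w : ℂ | 1 - w ∈ slitPlane} = (fun w : ℂ => 1 - w) '' slitPlane := by
    ext w
    constructor
    · intro h
      exact ⟨1 - w, h, by simp⟩
    · rintro ⟨v, hv, rfl⟩
      simpa using hv
  have hconn : IsPreconnected {w : ℂ | 1 - w ∈ slitPlane} := by
    rw [himg]
    have hslit : IsPreconnected slitPlane :=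
      (starConvex_one_slitPlane.isPathConnected one_mem_slitPlane).isConnected.isPreconnected
    exact hslit.image _ hcont.continuousOn
  have h0 : (0 : ℂ) ∈ {w : ℂ | 1 - w ∈ slitPlane} := by simp [one_mem_slitPlane]
  refine (hf.1.analyticOnNhd hopen).eqOn_of_preconnected_of_eventuallyEq
    (hg.1.analyticOnNhd hopen) hconn h0 ?_
  filter_upwards [Metric.ball_mem_nhds (0 : ℂ) one_pos] with w hw
  rw [hf.2 w hw, hg.2 w hw]

open Classical in
/-- The regularized Gauss hypergeometric function `₂F₁(a, b; c; w) / Γ(c)` (entire in `c`) on the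
plane cut along `[1, ∞)`: the value at `w` of the analytic continuation of its series. -/
noncomputable def gaussHG (a b c w : ℂ) : ℂ :=
  if h : ∃ f : ℂ → ℂ, IsGaussContinuation a b c f then h.choose w else 0

/-- Hobson's associated Legendre function of the first kind of degree `ν` and order `μ`, for `z` off
the cut `(-∞, 1]`:
`P_ν^μ(z) = ((z+1)/(z-1))^(μ/2) ₂F₁(-ν, ν+1; 1-μ; (1-z)/2) / Γ(1-μ)`,
with all powers determined by `-π < arg (z ± 1) < π`. -/
noncomputable def legendreP (ν μ z : ℂ) : ℂ :=
  (z + 1) ^ (μ / 2) / (z - 1) ^ (μ / 2) * gaussHG (-ν) (ν + 1) (1 - μ) ((1 - z) / 2)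

/-! Write `F(ν, μ)` for the regularized series `₂F₁(-ν, ν + 1; 1 + μ; w) / Γ(1 + μ)`. It has no
evident closed form along `(n + ε, m)`, but it has one along two other lines through `(n, m)`. Along
`(n, m + ε)` the parameter `a = -n` makes it a polynomial. Along `(n + ε, m + ε)` Euler's
transformation turns it into `(1 - w) ^ (m + ε)` times a series with upper parameter `c - b = m -
n`, again a polynomial. By the chain rule, `∂F/∂ν` is the derivative along the second line minus the
one along the first (`eqOn_deriv_family`). The logarithm comes from `(1 - w) ^ (m + ε)` and the
digammas from the Gamma factors in the coefficients.

The Legendre function itself has `c = 1 - m`. Its series starts at `w ^ m`, and together with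
Euler's transformation this writes it through `c = 1 + m` with the factor `(-1) ^ m (ν - m + 1)_{2m}
(w / (1 - w)) ^ m` (`isGaussContinuation_one_sub_nat`). Differentiating the Pochhammer factor adds
`ψ(n + m + 1) - ψ(n - m + 1)` to the `-2 ψ(n + m + 1)` of the diagonal line.

The series comparison is valid only on the unit disc, while the claim concerns the cut plane. So the
continuation must be differentiable in `ν`, with a holomorphic derivative there. Euler's integral
supplies this for `c = n + 3`, and the operator `c + w d/dw` carries it down to `c = 1 + m`
(`exists_family`). The identity theorem then extends the identities from the disc. -/

/-! ### Power series on the unit disc -/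

/-- `f` is the sum on the unit disc of the power series with coefficients `p`. -/
def IsPowerSum (f : ℂ → ℂ) (p : ℕ → ℂ) : Prop :=
  ∀ w ∈ Metric.ball (0 : ℂ) 1, HasSum (fun k => p k * w ^ k) (f w)

namespace IsPowerSum

theorem hasFPowerSeriesOnBall {f : ℂ → ℂ} {p : ℕ → ℂ} (h : IsPowerSum f p) :
    HasFPowerSeriesOnBall f (FormalMultilinearSeries.ofScalars ℂ p) 0 1 where
  r_le := by
    refine ENNReal.le_of_forall_nnreal_lt fun r hr => ?_
    have hr' : (r : ℝ) < 1 := by exact_mod_cast hr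
    refine FormalMultilinearSeries.le_radius_of_summable_norm _ ?_
    have := (h (r : ℂ) (by simpa using hr')).summable.norm
    refine this.congr fun k => ?_
    simp
  r_pos := one_pos
  hasSum := by
    intro y hy
    have hy' : y ∈ Metric.ball (0 : ℂ) 1 := by
      rwa [← ENNReal.ofReal_one, Metric.eball_ofReal] at hy
    simpa [mul_comm] using h y hy'

theorem differentiableOn {f : ℂ → ℂ} {p : ℕ → ℂ} (h : IsPowerSum f p) :
    DifferentiableOn ℂ f (Metric.ball 0 1) := by
  have := h.hasFPowerSeriesOnBall.differentiableOn
  rwa [← ENNReal.ofReal_one, Metric.eball_ofReal] at this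

theorem iteratedDeriv_eq {f : ℂ → ℂ} {p : ℕ → ℂ} (h : IsPowerSum f p) (k : ℕ) :
    iteratedDeriv k f 0 = k.factorial * p k := by
  have := h.hasFPowerSeriesOnBall.factorial_smul 1 k
  rw [iteratedDeriv_eq_iteratedFDeriv]
  simpa using this.symm

/-- A function holomorphic on the disc is the sum of its Taylor series on all of it, so only the
coefficients need identification. -/
theorem of_iteratedDeriv {f : ℂ → ℂ} {p : ℕ → ℂ} (hf : DifferentiableOn ℂ f (Metric.ball 0 1))
    (h : ∀ k, iteratedDeriv k f 0 = k.factorial * p k) : IsPowerSum f p := by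
  intro w hw
  have := Complex.hasSum_taylorSeries_on_ball hf hw
  refine this.congr_fun fun k => ?_
  have : (k.factorial : ℂ) ≠ 0 := by exact_mod_cast k.factorial_ne_zero
  rw [h k]
  simp only [sub_zero, smul_eq_mul]
  field_simp

theorem deriv {f : ℂ → ℂ} {p : ℕ → ℂ} (h : IsPowerSum f p) :
    IsPowerSum (deriv f) (fun k => (k + 1) * p (k + 1)) := by
  refine of_iteratedDeriv (h.differentiableOn.deriv Metric.isOpen_ball) fun k => ?_
  rw [← iteratedDeriv_succ', h.iteratedDeriv_eq, Nat.factorial_succ]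
  push_cast
  ring

theorem mul {f g : ℂ → ℂ} {p q : PowerSeries ℂ} (hf : IsPowerSum f fun k => p.coeff k)
    (hg : IsPowerSum g fun k => q.coeff k) :
    IsPowerSum (fun w => f w * g w) fun k => (p * q).coeff k := by
  intro w hw
  have h1 := (hf w hw).summable.norm
  have h2 := (hg w hw).summable.norm
  have h := (summable_norm_sum_mul_antidiagonal_of_summable_norm h1 h2).of_norm.hasSum
  rw [← tsum_mul_tsum_eq_tsum_sum_antidiagonal_of_summable_norm h1 h2, (hf w hw).tsum_eq,
    (hg w hw).tsum_eq] at h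
  refine h.congr_fun fun k => ?_
  simp only [PowerSeries.coeff_mul, Finset.sum_mul]
  refine Finset.sum_congr rfl fun x hx => ?_
  rw [← Finset.HasAntidiagonal.mem_antidiagonal.1 hx, pow_add]
  ring

/-- The Euler operator `w d/dw` multiplies the coefficient of `w ^ k` by `k`. As `1 / Γ(c + k) = (c
+ k) / Γ(c + k + 1)`, the operator `c + w d/dw` lowers the third hypergeometric parameter from `c +
1` to `c`. -/
theorem lower {f : ℂ → ℂ} {p : ℕ → ℂ} (h : IsPowerSum f p) (c : ℂ) :
    IsPowerSum (fun w => c * f w + w * _root_.deriv f w) (fun k => (c + k) * p k) := by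
  intro w hw
  have h1 := (h w hw).mul_left c
  have h2 := (h.deriv w hw).mul_left w
  have h3 : HasSum (fun k : ℕ => (k : ℂ) * p k * w ^ k) (w * _root_.deriv f w) := by
    rw [← hasSum_nat_add_iff' 1]
    simp only [Finset.sum_range_one, Nat.cast_zero, zero_mul, sub_zero]
    refine h2.congr_fun fun k => ?_
    push_cast
    ring
  refine (h1.add h3).congr_fun fun k => ?_
  ring

theorem const_mul_pow {f : ℂ → ℂ} {p : ℕ → ℂ} (h : IsPowerSum f p) (c : ℂ) (m : ℕ) :
    IsPowerSum (fun w => c * w ^ m * f w) (fun k => if k < m then 0 else c * p (k - m)) := by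
  intro w hw
  rw [← hasSum_nat_add_iff' m, Finset.sum_eq_zero, sub_zero]
  · refine ((h w hw).mul_left (c * w ^ m)).congr_fun fun k => ?_
    simp only [Nat.add_sub_cancel, pow_add, show ¬ k + m < m by omega, if_false]
    ring
  · intro k hk
    simp [Finset.mem_range.1 hk]

theorem eq {f g : ℂ → ℂ} {p q : ℕ → ℂ} (hf : IsPowerSum f p) (hg : IsPowerSum g q) (h : p = q)
    {w : ℂ} (hw : w ∈ Metric.ball (0 : ℂ) 1) : f w = g w :=
  (hf w hw).unique (h ▸ hg w hw)

end IsPowerSum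

/-! ### The regularized Gauss series and the binomial series -/

theorem isPowerSum_regularizedGaussHGFun (a b c : ℂ) :
    IsPowerSum (regularizedGaussHGFun a b c)
      fun k => (regularizedGaussHGFunSeries a b c).coeff k := by
  intro w hw
  have := (regularizedGaussHGFunSeries a b c).hasSum (x := w) ?_
  · refine this.congr_fun fun k => ?_
    simp [mul_comm]
  · have h1 : w ∈ Metric.eball (0 : ℂ) 1 := by
      rwa [← ENNReal.ofReal_one, Metric.eball_ofReal]
    exact Metric.eball_subset_eball (radius_regularizedGaussHGFunSeries_ge_one a b c) h1

theorem isPowerSum_one_sub_cpow (s : ℂ) :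
    IsPowerSum (fun w => (1 - w) ^ s)
      fun k => (ascPochhammer ℂ k).eval (-s) / k.factorial := by
  intro w hw
  have := (one_div_one_sub_cpow_hasFPowerSeriesOnBall_zero (-s)).hasSum (y := w) (by
    rwa [← ENNReal.ofReal_one, Metric.eball_ofReal])
  simp only [zero_add, cpow_neg, one_div, inv_inv] at this
  refine this.congr_fun fun k => ?_
  have hk : (k.factorial : ℂ) ≠ 0 := by exact_mod_cast k.factorial_ne_zero
  have h := Ring.descPochhammer_eq_factorial_smul_choose (-s + k - 1) k
  rw [Polynomial.descPochhammer_smeval_eq_ascPochhammer,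
    Polynomial.ascPochhammer_smeval_cast, Polynomial.ascPochhammer_smeval_eq_eval] at h
  have e : -s + k - 1 - k + 1 = -s := by ring
  rw [e, nsmul_eq_mul] at h
  simp only [h]
  simp
  field_simp

/-- The entire function `1 / Γ` satisfies its functional equation at the poles of `Γ` too, so no
condition on `c` is needed. -/
theorem coeff_regularizedGaussHGFunSeries_succ (a b c : ℂ) (k : ℕ) :
    (regularizedGaussHGFunSeries a b c).coeff (k + 1) * ((k + 1) * (c + k)) =
      (regularizedGaussHGFunSeries a b c).coeff k * ((a + k) * (b + k)) := by
  simp only [coeff_regularizedGaussHGFunSeries, ascPochhammer_succ_eval, Nat.factorial_succ]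
  have h := one_div_Gamma_eq_self_mul_one_div_Gamma_add_one (c + k)
  have hk : (k.factorial : ℂ) ≠ 0 := by exact_mod_cast k.factorial_ne_zero
  have hk1 : (k : ℂ) + 1 ≠ 0 := by exact_mod_cast k.succ_ne_zero
  simp only [div_eq_mul_inv, mul_inv]
  rw [h]
  push_cast
  rw [← add_assoc]
  field_simp

/-! ### The formal hypergeometric equation and Euler's transformation -/

section Formal

open PowerSeries

/-- The formal hypergeometric differential equation in terms of coefficients. -/
theorem coeff_gauss_ode (a b c : ℂ) (p : PowerSeries ℂ) (k : ℕ) :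
    (X * (1 - X) * d⁄dX ℂ (d⁄dX ℂ p) + (C c - C (a + b + 1) * X) * d⁄dX ℂ p
      - C (a * b) * p).coeff k =
      p.coeff (k + 1) * ((k + 1) * (c + k)) - p.coeff k * ((a + k) * (b + k)) := by
  have e : X * (1 - X) * d⁄dX ℂ (d⁄dX ℂ p) + (C c - C (a + b + 1) * X) * d⁄dX ℂ p
      - C (a * b) * p = X * d⁄dX ℂ (d⁄dX ℂ p) - X * (X * d⁄dX ℂ (d⁄dX ℂ p)) + C c * d⁄dX ℂ p
        - C (a + b + 1) * (X * d⁄dX ℂ p) - C (a * b) * p := by ring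
  rw [e]
  rcases k with _ | _ | k <;>
    rw [map_sub, map_sub, map_add, map_sub, coeff_C_mul, coeff_C_mul, coeff_C_mul] <;>
    simp only [coeff_zero_X_mul, coeff_succ_X_mul,
      coeff_derivative, zero_add] <;>
    push_cast <;> ring

theorem gauss_ode_iff (a b c : ℂ) (p : PowerSeries ℂ) :
    X * (1 - X) * d⁄dX ℂ (d⁄dX ℂ p) + (C c - C (a + b + 1) * X) * d⁄dX ℂ p
      - C (a * b) * p = 0 ↔
      ∀ k : ℕ, p.coeff (k + 1) * ((k + 1) * (c + k)) = p.coeff k * ((a + k) * (b + k)) := by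
  rw [PowerSeries.ext_iff]
  simp only [coeff_gauss_ode, map_zero, sub_eq_zero]

/-- `hG` says that `G` is a multiple of `(1 - X) ^ (c - a - b)`. Multiplication by it carries
solutions with parameters `c - a, c - b` to solutions with parameters `a, b`. -/
theorem gauss_ode_mul {a b c : ℂ} {G p : PowerSeries ℂ}
    (hG : (1 - X) * d⁄dX ℂ G = -C (c - a - b) * G)
    (hp : X * (1 - X) * d⁄dX ℂ (d⁄dX ℂ p) + (C c - C (c - a + (c - b) + 1) * X) * d⁄dX ℂ p
      - C ((c - a) * (c - b)) * p = 0) :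
    X * (1 - X) * d⁄dX ℂ (d⁄dX ℂ (G * p)) + (C c - C (a + b + 1) * X) * d⁄dX ℂ (G * p)
      - C (a * b) * (G * p) = 0 := by
  have hG2 := congrArg (d⁄dX ℂ) hG
  simp only [Derivation.leibniz, map_sub, map_add, map_mul, map_neg, smul_eq_mul, derivative_X,
    derivative_C, derivative_one, map_one] at hG hp hG2 ⊢
  have hne : (1 - X : PowerSeries ℂ) ≠ 0 := by
    intro h
    have := congrArg (constantCoeff (R := ℂ)) h
    simp at this
  -- The extra factor `1 - X` lets `hG` and its derivative eliminate both derivatives of `G` without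
  -- division.
  refine (mul_eq_zero.1 ?_).resolve_left hne
  generalize d⁄dX ℂ (d⁄dX ℂ p) = p2 at *
  generalize d⁄dX ℂ (d⁄dX ℂ G) = G2 at *
  generalize d⁄dX ℂ p = p1 at *
  generalize d⁄dX ℂ G = G1 at *
  generalize (C a : PowerSeries ℂ) = A at *
  generalize (C b : PowerSeries ℂ) = B at *
  generalize (C c : PowerSeries ℂ) = K at *
  linear_combination (X * (1 - X) * p) * hG2 +
    ((1 - (K - A - B)) * X * p + 2 * X * (1 - X) * p1 + (K - (A + B + 1) * X) * p) * hG +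
    (1 - X) * G * hp

/-- Two formal solutions of the hypergeometric equation with the same constant term agree. -/
theorem gauss_ode_unique {a b c : ℂ} (hc : ∀ k : ℕ, c ≠ -k) {p q : PowerSeries ℂ}
    (hp : ∀ k : ℕ, p.coeff (k + 1) * ((k + 1) * (c + k)) = p.coeff k * ((a + k) * (b + k)))
    (hq : ∀ k : ℕ, q.coeff (k + 1) * ((k + 1) * (c + k)) = q.coeff k * ((a + k) * (b + k)))
    (h : p.coeff 0 = q.coeff 0) : p = q := by
  ext k
  induction k with
  | zero => exact h
  | succ k ih =>
    have h1 : ((k : ℂ) + 1) * (c + k) ≠ 0 :=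
      mul_ne_zero (by exact_mod_cast k.succ_ne_zero) fun h => hc k (eq_neg_of_add_eq_zero_left h)
    exact mul_right_cancel₀ h1 (by rw [hp, hq, ih])

theorem one_sub_mul_derivative_binomial (s : ℂ) :
    (1 - X) * d⁄dX ℂ (mk fun k => (ascPochhammer ℂ k).eval (-s) / k.factorial) =
      -C s * mk fun k => (ascPochhammer ℂ k).eval (-s) / k.factorial := by
  ext k
  have key : ∀ j : ℕ, (ascPochhammer ℂ (j + 1)).eval (-s) / (j + 1).factorial * (j + 1) =
      (ascPochhammer ℂ j).eval (-s) / j.factorial * (-s + j) := fun j => by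
    have hj : (j.factorial : ℂ) ≠ 0 := by exact_mod_cast j.factorial_ne_zero
    have hj1 : (j : ℂ) + 1 ≠ 0 := by exact_mod_cast j.succ_ne_zero
    rw [ascPochhammer_succ_eval, Nat.factorial_succ]
    push_cast
    field_simp
  rw [sub_mul, one_mul, map_sub, neg_mul, map_neg, coeff_C_mul]
  rcases k with _ | k
  · have := key 0
    simp only [coeff_zero_X_mul, coeff_derivative, coeff_mk]
    linear_combination this
  · have := key (k + 1)
    simp only [coeff_succ_X_mul, coeff_derivative, coeff_mk]
    push_cast at this ⊢
    linear_combination this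

/-- Euler's transformation on the unit disc. -/
theorem regularizedGaussHGFun_euler (a b : ℂ) {c : ℂ} (hc : ∀ k : ℕ, c ≠ -k) {w : ℂ}
    (hw : w ∈ Metric.ball (0 : ℂ) 1) :
    regularizedGaussHGFun a b c w =
      (1 - w) ^ (c - a - b) * regularizedGaussHGFun (c - a) (c - b) c w := by
  set G : PowerSeries ℂ := mk fun k => (ascPochhammer ℂ k).eval (-(c - a - b)) / k.factorial
  set p : PowerSeries ℂ := mk fun k => (regularizedGaussHGFunSeries (c - a) (c - b) c).coeff k
  set q : PowerSeries ℂ := mk fun k => (regularizedGaussHGFunSeries a b c).coeff k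
  have hp := (gauss_ode_iff (c - a) (c - b) c p).2 fun k => by
    simpa [p] using coeff_regularizedGaussHGFunSeries_succ (c - a) (c - b) c k
  have hGp := (gauss_ode_iff a b c (G * p)).1
    (gauss_ode_mul (one_sub_mul_derivative_binomial _) hp)
  have hq : q = G * p := by
    refine gauss_ode_unique hc (fun k => ?_) hGp ?_
    · simpa [q] using coeff_regularizedGaussHGFunSeries_succ a b c k
    · simp [G, p, q, coeff_mul, coeff_regularizedGaussHGFunSeries]
  have hG : IsPowerSum (fun w => (1 - w) ^ (c - a - b)) fun k => G.coeff k := by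
    simpa only [G, coeff_mk] using isPowerSum_one_sub_cpow (c - a - b)
  have hP : IsPowerSum (regularizedGaussHGFun (c - a) (c - b) c) fun k => p.coeff k := by
    simpa only [p, coeff_mk] using isPowerSum_regularizedGaussHGFun (c - a) (c - b) c
  refine (isPowerSum_regularizedGaussHGFun a b c).eq (hG.mul hP) ?_ hw
  funext k
  rw [← hq, coeff_mk]

end Formal

/-! ### The degenerate parameter `c = 1 - m` -/

theorem ascPochhammer_eval_add (m k : ℕ) (a : ℂ) :
    (ascPochhammer ℂ (m + k)).eval a =
      (ascPochhammer ℂ m).eval a * (ascPochhammer ℂ k).eval (a + m) := by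
  rw [← ascPochhammer_mul]
  simp

/-- For `c = 1 - m` the regularized series starts at `w ^ m`. -/
theorem regularizedGaussHGFun_one_sub_nat (a b : ℂ) (m : ℕ) {w : ℂ}
    (hw : w ∈ Metric.ball (0 : ℂ) 1) :
    regularizedGaussHGFun a b (1 - m) w =
      (ascPochhammer ℂ m).eval a * (ascPochhammer ℂ m).eval b * w ^ m *
        regularizedGaussHGFun (a + m) (b + m) (1 + m) w := by
  refine (isPowerSum_regularizedGaussHGFun a b (1 - m)).eq
    ((isPowerSum_regularizedGaussHGFun (a + m) (b + m) (1 + m)).const_mul_pow _ m) ?_ hw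
  funext k
  split_ifs with hk
  · rw [coeff_regularizedGaussHGFunSeries]
    -- For `k < m` the argument is a pole of `Γ`, so the coefficient vanishes.
    have : (1 - m + k : ℂ) = -((m - 1 - k : ℕ) : ℂ) := by
      rw [Nat.cast_sub (by omega), Nat.cast_sub (by omega)]
      push_cast
      ring
    rw [this, Gamma_neg_nat_eq_zero]
    simp
  · obtain ⟨j, rfl⟩ := Nat.exists_eq_add_of_le (not_lt.1 hk)
    simp only [coeff_regularizedGaussHGFunSeries, ascPochhammer_eval_add, Nat.add_sub_cancel_left]
    have e1 : (1 - m + (m + j : ℕ) : ℂ) = j + 1 := by push_cast; ring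
    have e2 : (1 + m + j : ℂ) = (m + j : ℕ) + 1 := by push_cast; ring
    rw [e1, e2, Gamma_nat_eq_factorial, Gamma_nat_eq_factorial]
    ring

/-! ### Locally uniform differentiation in a parameter -/

open Filter Topology in
/-- `F` is a family of holomorphic functions on `U` which has, locally uniformly on `U`, the
derivative `G` with respect to the parameter at `x₀`. -/
structure HasLocUnifDerivAt (F : ℂ → ℂ → ℂ) (G : ℂ → ℂ) (x₀ : ℂ) (U : Set ℂ) : Prop where
  eventually_differentiableOn : ∀ᶠ x in 𝓝 x₀, DifferentiableOn ℂ (F x) U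
  tendsto : TendstoLocallyUniformlyOn (fun x w => (x - x₀)⁻¹ * (F x w - F x₀ w)) G (𝓝[≠] x₀) U

namespace HasLocUnifDerivAt

open Filter Topology

variable {F : ℂ → ℂ → ℂ} {G : ℂ → ℂ} {x₀ : ℂ} {U : Set ℂ}

theorem hasDerivAt (h : HasLocUnifDerivAt F G x₀ U) {w : ℂ} (hw : w ∈ U) :
    HasDerivAt (fun x => F x w) (G w) x₀ := by
  rw [hasDerivAt_iff_tendsto_slope]
  simpa [slope_fun_def] using h.tendsto.tendsto_at hw

theorem eventually_slope (h : HasLocUnifDerivAt F G x₀ U) :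
    ∀ᶠ x in 𝓝[≠] x₀, DifferentiableOn ℂ (fun w => (x - x₀)⁻¹ * (F x w - F x₀ w)) U :=
  (h.eventually_differentiableOn.filter_mono nhdsWithin_le_nhds).mono fun _ hx =>
    (hx.sub h.eventually_differentiableOn.self_of_nhds).const_mul _

theorem differentiableOn (h : HasLocUnifDerivAt F G x₀ U) (hU : IsOpen U) :
    DifferentiableOn ℂ G U :=
  h.tendsto.differentiableOn h.eventually_slope hU

theorem mono (h : HasLocUnifDerivAt F G x₀ U) {V : Set ℂ} (hV : V ⊆ U) :
    HasLocUnifDerivAt F G x₀ V :=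
  ⟨h.eventually_differentiableOn.mono fun _ hx => hx.mono hV, h.tendsto.mono hV⟩

/-- Weierstrass: locally uniform convergence of holomorphic difference quotients passes to their
derivatives in `w`. -/
theorem deriv (h : HasLocUnifDerivAt F G x₀ U) (hU : IsOpen U) :
    HasLocUnifDerivAt (fun x => deriv (F x)) (deriv G) x₀ U where
  eventually_differentiableOn := h.eventually_differentiableOn.mono fun _ hx => hx.deriv hU
  tendsto := by
    rw [tendstoLocallyUniformlyOn_iff_forall_isCompact hU]
    intro K hK hKc
    refine ((tendstoLocallyUniformlyOn_iff_forall_isCompact hU).1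
      (h.tendsto.deriv h.eventually_slope hU) K hK hKc).congr ?_
    filter_upwards [h.eventually_differentiableOn.filter_mono nhdsWithin_le_nhds] with x hx w hw
    have hw' := hU.mem_nhds (hK hw)
    have h1 := hx.differentiableAt hw'
    have h2 := h.eventually_differentiableOn.self_of_nhds.differentiableAt hw'
    have := (h1.hasDerivAt.sub h2.hasDerivAt).const_mul (x - x₀)⁻¹
    exact this.deriv

theorem iteratedDeriv (h : HasLocUnifDerivAt F G x₀ U) (hU : IsOpen U) (k : ℕ) :
    HasLocUnifDerivAt (fun x => iteratedDeriv k (F x)) (iteratedDeriv k G) x₀ U := by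
  induction k with
  | zero => simpa using h
  | succ k ih => simpa only [iteratedDeriv_succ] using ih.deriv hU

theorem add_const_mul_deriv (h : HasLocUnifDerivAt F G x₀ U) (hU : IsOpen U) (c : ℂ) :
    HasLocUnifDerivAt (fun x w => c * F x w + w * _root_.deriv (F x) w)
      (fun w => c * G w + w * _root_.deriv G w) x₀ U where
  eventually_differentiableOn := h.eventually_differentiableOn.mono fun _ hx =>
    (hx.const_mul c).add (differentiableOn_id.mul (hx.deriv hU))
  tendsto := by
    rw [tendstoLocallyUniformlyOn_iff_forall_isCompact hU]
    intro K hK hKc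
    have h1 := (tendstoLocallyUniformlyOn_iff_forall_isCompact hU).1 h.tendsto K hK hKc
    have h2 := (tendstoLocallyUniformlyOn_iff_forall_isCompact hU).1 (h.deriv hU).tendsto K hK hKc
    obtain ⟨M, hM⟩ := hKc.exists_bound_of_continuousOn (f := fun w : ℂ => w) continuousOn_id
    rw [Metric.tendstoUniformlyOn_iff] at h1 h2 ⊢
    intro ε hε
    have hA : 0 < ‖c‖ + |M| + 1 := by positivity
    filter_upwards [h1 (ε / (2 * (‖c‖ + |M| + 1))) (by positivity),
      h2 (ε / (2 * (‖c‖ + |M| + 1))) (by positivity)] with x hx1 hx2 w hw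
    have e1 := hx1 w hw
    have e2 := hx2 w hw
    have e3 : ‖w‖ ≤ |M| := (hM w hw).trans (le_abs_self M)
    rw [dist_eq_norm] at e1 e2 ⊢
    set a := G w - (x - x₀)⁻¹ * (F x w - F x₀ w)
    set b := _root_.deriv G w - (x - x₀)⁻¹ * (_root_.deriv (F x) w - _root_.deriv (F x₀) w)
    have : c * G w + w * _root_.deriv G w - (x - x₀)⁻¹ * (c * F x w + w * _root_.deriv (F x) w
        - (c * F x₀ w + w * _root_.deriv (F x₀) w)) = c * a + w * b := by
      simp only [a, b]; ring
    rw [this]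
    set δ := ε / (2 * (‖c‖ + |M| + 1)) with hδ
    have hδε : δ * (2 * (‖c‖ + |M| + 1)) = ε := by rw [hδ]; field_simp
    have hδ0 : 0 < δ := by positivity
    calc ‖c * a + w * b‖ ≤ ‖c‖ * ‖a‖ + ‖w‖ * ‖b‖ := by
          refine (norm_add_le _ _).trans ?_
          rw [norm_mul, norm_mul]
      _ ≤ ‖c‖ * δ + |M| * δ := by gcongr
      _ < ε := by nlinarith [norm_nonneg c, abs_nonneg M]

/-- This permits termwise differentiation in the parameter: the Taylor coefficients of `G` at `0`
are limits of those of the difference quotients. -/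
theorem isPowerSum {p : ℂ → ℕ → ℂ} {p' : ℕ → ℂ}
    (h : HasLocUnifDerivAt F G x₀ (Metric.ball 0 1)) (hp : ∀ᶠ x in 𝓝 x₀, IsPowerSum (F x) (p x))
    (hp' : ∀ k, HasDerivAt (fun x => p x k) (p' k) x₀) : IsPowerSum G p' := by
  refine .of_iteratedDeriv (h.differentiableOn Metric.isOpen_ball) fun k => ?_
  have h1 := (h.iteratedDeriv Metric.isOpen_ball k).hasDerivAt (Metric.mem_ball_self one_pos)
  refine h1.unique (((hp' k).const_mul _).congr_of_eventuallyEq ?_)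
  filter_upwards [hp] with x hx using hx.iteratedDeriv_eq k

/-- The Schwarz lemma applied twice: first it bounds the divided slope `dslope f x₀` by `2 * M / r`,
then it bounds the variation of that slope. The constant depends on `f` only through `M`, whence
uniformity. -/
theorem norm_slope_sub_deriv_le {f : ℂ → ℂ} {r M : ℝ}
    (hf : DifferentiableOn ℂ f (Metric.ball x₀ r)) (hM : ∀ x ∈ Metric.ball x₀ r, ‖f x‖ ≤ M)
    {x : ℂ} (hx : x ∈ Metric.ball x₀ r) (hne : x ≠ x₀) :
    ‖_root_.deriv f x₀ - (x - x₀)⁻¹ * (f x - f x₀)‖ ≤ 4 * M / r ^ 2 * ‖x - x₀‖ := by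
  have hr : 0 < r := Metric.nonempty_ball.1 ⟨x, hx⟩
  have h0 : x₀ ∈ Metric.ball x₀ r := Metric.mem_ball_self hr
  have h1 : ∀ y ∈ Metric.ball x₀ r, ‖dslope f x₀ y‖ ≤ 2 * M / r := fun y hy =>
    norm_dslope_le_div_of_mapsTo_ball hf (fun u hu => by
      rw [mem_closedBall_iff_norm]
      linarith [norm_sub_le (f u) (f x₀), hM u hu, hM x₀ h0]) hy
  have h2 : DifferentiableOn ℂ (dslope f x₀) (Metric.ball x₀ r) :=
    (differentiableOn_dslope (Metric.ball_mem_nhds x₀ hr)).2 hf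
  have h3 := dist_le_div_mul_dist_of_mapsTo_ball (R₂ := 2 * (2 * M / r)) h2 (fun u hu => by
      rw [mem_closedBall_iff_norm]
      linarith [norm_sub_le (dslope f x₀ u) (dslope f x₀ x₀), h1 u hu, h1 x₀ h0]) hx
  rw [dslope_same, dslope_of_ne _ hne, slope_def_module, smul_eq_mul, dist_comm, dist_eq_norm,
    dist_eq_norm] at h3
  refine h3.trans_eq ?_
  field_simp
  ring

/-- A locally bounded family, holomorphic in both variables, is differentiable locally uniformly. -/
theorem of_bounded (hU : IsOpen U) {r : ℝ} (hr : 0 < r)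
    (hF : ∀ x ∈ Metric.ball x₀ r, DifferentiableOn ℂ (F x) U)
    (hF' : ∀ w ∈ U, DifferentiableOn ℂ (fun x => F x w) (Metric.ball x₀ r))
    (hM : ∀ K ⊆ U, IsCompact K → ∃ M, ∀ x ∈ Metric.ball x₀ r, ∀ w ∈ K, ‖F x w‖ ≤ M) :
    HasLocUnifDerivAt F (fun w => _root_.deriv (fun x => F x w) x₀) x₀ U where
  eventually_differentiableOn := by
    filter_upwards [Metric.ball_mem_nhds x₀ hr] with x hx using hF x hx
  tendsto := by
    rw [tendstoLocallyUniformlyOn_iff_forall_isCompact hU]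
    intro K hK hKc
    obtain ⟨M, hM⟩ := hM K hK hKc
    rw [Metric.tendstoUniformlyOn_iff]
    intro ε hε
    have hcont : Tendsto (fun x : ℂ => 4 * M / r ^ 2 * ‖x - x₀‖) (𝓝[≠] x₀) (𝓝 0) := by
      have : Continuous fun x : ℂ => 4 * M / r ^ 2 * ‖x - x₀‖ := by fun_prop
      have := this.tendsto x₀
      simp only [sub_self, norm_zero, mul_zero] at this
      exact this.mono_left nhdsWithin_le_nhds
    filter_upwards [hcont.eventually (gt_mem_nhds hε), self_mem_nhdsWithin,
      nhdsWithin_le_nhds (Metric.ball_mem_nhds x₀ hr)] with x h1 h2 h3 w hw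
    rw [dist_eq_norm]
    exact (norm_slope_sub_deriv_le (hF' w (hK hw)) (fun y hy => hM y hy w hw) h3 h2).trans_lt h1

/-- A jointly continuous family, holomorphic in both variables, is differentiable locally
uniformly. -/
theorem of_continuousOn (hU : IsOpen U) {r : ℝ} (hr : 0 < r)
    (hF : ∀ x ∈ Metric.ball x₀ r, DifferentiableOn ℂ (F x) U)
    (hF' : ∀ w ∈ U, DifferentiableOn ℂ (fun x => F x w) (Metric.ball x₀ r))
    (hc : ContinuousOn (fun q : ℂ × ℂ => F q.1 q.2) (Metric.closedBall x₀ r ×ˢ U)) :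
    HasLocUnifDerivAt F (fun w => _root_.deriv (fun x => F x w) x₀) x₀ U := by
  refine of_bounded hU hr hF hF' fun K hK hKc => ?_
  obtain ⟨M, hM⟩ := ((isCompact_closedBall x₀ r).prod hKc).exists_bound_of_continuousOn
    (hc.mono (Set.prod_mono le_rfl hK))
  exact ⟨M, fun x hx w hw => hM (x, w) ⟨Metric.ball_subset_closedBall hx, hw⟩⟩

end HasLocUnifDerivAt

/-! ### Holomorphic parameter integrals -/

section ParametricIntegral

open MeasureTheory Filter Topology

/-- An integral of functions holomorphic in a parameter is holomorphic if it is dominated. -/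
theorem differentiableAt_integral_of_norm_le {α : Type*} [MeasurableSpace α] {μ : Measure α}
    {F : ℂ → α → ℂ} {bound : α → ℝ} {x₀ : ℂ} {r : ℝ} (hr : 0 < r)
    (hmeas : ∀ x ∈ Metric.ball x₀ r, AEStronglyMeasurable (F x) μ)
    (hdiff : ∀ᵐ t ∂μ, DifferentiableOn ℂ (fun x => F x t) (Metric.ball x₀ r))
    (hb : ∀ᵐ t ∂μ, ∀ x ∈ Metric.ball x₀ r, ‖F x t‖ ≤ bound t) (hbi : Integrable bound μ) :
    DifferentiableAt ℂ (fun x => ∫ t, F x t ∂μ) x₀ := by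
  have h0 : x₀ ∈ Metric.ball x₀ r := Metric.mem_ball_self hr
  -- Since `r / 2 + r / 3 < r`, Cauchy's estimate on circles of radius `r / 3` bounds the derivative
  -- by `bound t / (r / 3)`.
  have hsub : ∀ x ∈ Metric.ball x₀ (r / 2), Metric.closedBall x (r / 3) ⊆ Metric.ball x₀ r := by
    intro x hx
    refine Metric.closedBall_subset_ball' ?_
    have := Metric.mem_ball.1 hx
    linarith
  refine (hasDerivAt_integral_of_dominated_loc_of_deriv_le (F := F)
    (F' := fun x t => deriv (fun x => F x t) x) (bound := fun t => bound t / (r / 3))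
    (Metric.ball_mem_nhds x₀ (half_pos hr)) ?_ ?_ ?_ ?_ (hbi.div_const _) ?_).2.differentiableAt
  · filter_upwards [Metric.ball_mem_nhds x₀ hr] with x hx using hmeas x hx
  · exact hbi.mono' (hmeas x₀ h0) (hb.mono fun t ht => ht x₀ h0)
  -- Measurability of the derivative in `t`: it is the pointwise limit of slopes along a sequence
  -- tending to `x₀`.
  · have hlim : Tendsto (fun j : ℕ => x₀ + (r / 2 : ℝ) * (1 / ((j : ℂ) + 1))) atTop (𝓝[≠] x₀) := by
      refine tendsto_nhdsWithin_iff.2 ⟨?_, .of_forall fun j => ?_⟩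
      · have := (tendsto_one_div_add_atTop_nhds_zero_nat (𝕜 := ℂ)).const_mul ((r / 2 : ℝ) : ℂ)
        simpa using this.const_add x₀
      · have : (j : ℂ) + 1 ≠ 0 := by exact_mod_cast j.succ_ne_zero
        simp [hr.ne', this]
    refine aestronglyMeasurable_of_tendsto_ae (u := atTop)
      (f := fun (j : ℕ) t => slope (fun x => F x t) x₀ (x₀ + (r / 2 : ℝ) * (1 / ((j : ℂ) + 1))))
      (fun j => ?_) ?_
    · simp only [slope_def_field]
      have hj : x₀ + (r / 2 : ℝ) * (1 / ((j : ℂ) + 1)) ∈ Metric.ball x₀ r := by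
        rw [mem_ball_iff_norm, add_sub_cancel_left, norm_mul, norm_real,
          norm_div 1 ((j : ℂ) + 1), norm_one]
        have h1 : ‖(j : ℂ) + 1‖ = j + 1 := by
          exact_mod_cast norm_natCast (j + 1)
        have h2 : (1 : ℝ) / (j + 1) ≤ 1 := by
          rw [div_le_one (by positivity)]
          linarith [j.cast_nonneg (α := ℝ)]
        rw [h1, Real.norm_of_nonneg (by positivity)]
        nlinarith
      exact ((hmeas _ hj).sub (hmeas x₀ h0)).mul aestronglyMeasurable_const
    · filter_upwards [hdiff] with t ht
      exact (hasDerivAt_iff_tendsto_slope.1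
        (ht.differentiableAt (Metric.ball_mem_nhds x₀ hr)).hasDerivAt).comp hlim
  · filter_upwards [hdiff, hb] with t ht htb x hx
    refine norm_deriv_le_of_forall_mem_sphere_norm_le (by positivity) ?_ fun z hz =>
      htb z (hsub x hx (Metric.sphere_subset_closedBall hz))
    refine DifferentiableOn.diffContOnCl (ht.mono ?_)
    exact Metric.closure_ball_subset_closedBall.trans (hsub x hx)
  · filter_upwards [hdiff] with t ht x hx
    exact (ht.differentiableAt (Metric.isOpen_ball.mem_nhds
      (Metric.ball_subset_ball (by linarith) hx))).hasDerivAt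

end ParametricIntegral

/-! ### The cut plane -/

/-- The plane cut along `[1, ∞)`. -/
def cutPlane : Set ℂ := {w | 1 - w ∈ slitPlane}

theorem isOpen_cutPlane : IsOpen cutPlane :=
  isOpen_slitPlane.preimage (f := fun w : ℂ => 1 - w) (by fun_prop)

theorem ball_subset_cutPlane : Metric.ball (0 : ℂ) 1 ⊆ cutPlane := fun w hw => by
  have : ‖-w‖ < 1 := by simpa using hw
  simpa [cutPlane, sub_eq_add_neg] using mem_slitPlane_of_norm_lt_one this

theorem isPreconnected_cutPlane : IsPreconnected cutPlane := by
  have himg : cutPlane = (fun w : ℂ => 1 - w) '' slitPlane := by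
    ext w
    exact ⟨fun h => ⟨1 - w, h, by simp⟩, by rintro ⟨v, hv, rfl⟩; simpa [cutPlane] using hv⟩
  rw [himg]
  have h := (starConvex_one_slitPlane.isPathConnected one_mem_slitPlane).isConnected
  exact h.isPreconnected.image _ (by fun_prop)

theorem eqOn_cutPlane {f g : ℂ → ℂ} (hf : DifferentiableOn ℂ f cutPlane)
    (hg : DifferentiableOn ℂ g cutPlane) (h : ∀ w ∈ Metric.ball (0 : ℂ) 1, f w = g w) :
    Set.EqOn f g cutPlane := by
  refine (hf.analyticOnNhd isOpen_cutPlane).eqOn_of_preconnected_of_eventuallyEq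
    (hg.analyticOnNhd isOpen_cutPlane) isPreconnected_cutPlane
    (ball_subset_cutPlane (Metric.mem_ball_self one_pos)) ?_
  filter_upwards [Metric.ball_mem_nhds (0 : ℂ) one_pos] with w hw using h w hw

theorem one_sub_mul_mem_slitPlane {w : ℂ} (hw : w ∈ cutPlane) {t : ℝ} (ht : t ∈ Set.Icc (0 : ℝ) 1) :
    1 - w * t ∈ slitPlane := by
  have := starConvex_one_slitPlane hw (a := 1 - t) (b := t) (by linarith [ht.2]) ht.1 (by ring)
  convert this using 1
  simp only [real_smul]
  push_cast
  ring

/-! ### Euler's integral -/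

section EulerIntegral

open MeasureTheory Filter Topology

/-- The integrand of Euler's integral for `₂F₁(-ν, ν + 1; N + 2; w)`. -/
noncomputable def eulerKernel (N ν w : ℂ) (t : ℝ) : ℂ :=
  (t : ℂ) ^ ν * (1 - t : ℂ) ^ (N - ν) * (1 - w * t) ^ ν

/-- Euler's integral for the regularized function `₂F₁(-ν, ν + 1; N + 2; w)`. -/
noncomputable def eulerIntegral (N ν w : ℂ) : ℂ :=
  (Gamma (ν + 1))⁻¹ * (Gamma (N + 1 - ν))⁻¹ * ∫ t in Set.Ioo (0 : ℝ) 1, eulerKernel N ν w t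

theorem integrableOn_rpow_neg_half :
    IntegrableOn (fun t : ℝ => t ^ (-(1 / 2) : ℝ)) (Set.Ioo 0 1) := by
  have := (intervalIntegral.intervalIntegrable_rpow' (a := 0) (b := 1)
    (r := -(1 / 2)) (by norm_num)).1
  exact this.mono_set Set.Ioo_subset_Ioc_self

variable {n : ℕ} {ν : ℂ}

theorem re_bounds_of_mem_ball (hν : ν ∈ Metric.ball (n : ℂ) (1 / 2)) :
    -(1 / 2) < ν.re ∧ ν.re < n + 1 / 2 := by
  have h1 := (abs_re_le_norm (ν - n)).trans_lt (mem_ball_iff_norm.1 hν)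
  rw [sub_re, natCast_re, abs_lt] at h1
  exact ⟨by linarith [n.cast_nonneg (α := ℝ)], by linarith⟩

/-- With `N = n + 1` the exponent of `1 - t` has positive real part, so the endpoint `1` is
harmless. At `0` the exponent satisfies only `Re ν > -1/2` (near the bound when `n = 0`), which is
still integrable. -/
theorem norm_beta_kernel_le (hν : ν ∈ Metric.ball (n : ℂ) (1 / 2)) {t : ℝ}
    (ht : t ∈ Set.Ioo (0 : ℝ) 1) :
    ‖(t : ℂ) ^ ν * (1 - t : ℂ) ^ ((n + 1 : ℂ) - ν)‖ ≤ t ^ (-(1 / 2) : ℝ) := by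
  obtain ⟨h1, h2⟩ := re_bounds_of_mem_ball hν
  have e : (1 - t : ℂ) = ((1 - t : ℝ) : ℂ) := by push_cast; rfl
  rw [norm_mul, e, norm_cpow_eq_rpow_re_of_pos ht.1,
    norm_cpow_eq_rpow_re_of_pos (by linarith [ht.2])]
  have h3 : (1 - t) ^ ((n + 1 : ℂ) - ν).re ≤ 1 := by
    refine Real.rpow_le_one (by linarith [ht.2]) (by linarith [ht.1]) ?_
    simp only [sub_re, add_re, natCast_re, one_re]
    linarith
  have h4 : t ^ ν.re ≤ t ^ (-(1 / 2) : ℝ) :=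
    Real.rpow_le_rpow_of_exponent_ge ht.1 ht.2.le h1.le
  calc _ ≤ t ^ (-(1 / 2) : ℝ) * 1 := by
        gcongr
        · exact Real.rpow_nonneg (by linarith [ht.2]) _
        · exact Real.rpow_nonneg ht.1.le _
    _ = _ := mul_one _

/-- `1 - w * t` stays in the slit plane even for `t = 0` and `t = 1`, so the power is jointly
continuous on a compact set. -/
theorem exists_norm_cpow_le {K : Set ℂ} (hK : K ⊆ cutPlane) (hKc : IsCompact K) :
    ∃ M, 0 ≤ M ∧ ∀ ν ∈ Metric.ball (n : ℂ) (1 / 2), ∀ w ∈ K, ∀ t ∈ Set.Ioo (0 : ℝ) 1,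
      ‖(1 - w * t : ℂ) ^ ν‖ ≤ M := by
  have hc : ContinuousOn (fun q : (ℂ × ℂ) × ℝ => (1 - q.1.2 * q.2 : ℂ) ^ q.1.1)
      ((Metric.closedBall (n : ℂ) (1 / 2) ×ˢ K) ×ˢ Set.Icc (0 : ℝ) 1) := by
    refine ContinuousOn.cpow (by fun_prop) (by fun_prop) fun q hq => ?_
    exact one_sub_mul_mem_slitPlane (hK hq.1.2) hq.2
  obtain ⟨M, hM⟩ := (((isCompact_closedBall (n : ℂ) (1 / 2)).prod hKc).prod
    (isCompact_Icc (a := (0 : ℝ)) (b := 1))).exists_bound_of_continuousOn hc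
  exact ⟨|M|, abs_nonneg _, fun ν hν w hw t ht => (hM ((ν, w), t)
    ⟨⟨Metric.ball_subset_closedBall hν, hw⟩, Set.Ioo_subset_Icc_self ht⟩).trans (le_abs_self M)⟩

theorem exists_norm_eulerKernel_le {K : Set ℂ} (hK : K ⊆ cutPlane) (hKc : IsCompact K) :
    ∃ M, 0 ≤ M ∧ ∀ ν ∈ Metric.ball (n : ℂ) (1 / 2), ∀ w ∈ K, ∀ t ∈ Set.Ioo (0 : ℝ) 1,
      ‖eulerKernel (n + 1) ν w t‖ ≤ M * t ^ (-(1 / 2) : ℝ) := by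
  obtain ⟨M, hM0, hM⟩ := exists_norm_cpow_le (n := n) hK hKc
  refine ⟨M, hM0, fun ν hν w hw t ht => ?_⟩
  rw [eulerKernel, norm_mul, mul_comm]
  exact mul_le_mul (hM ν hν w hw t ht) (norm_beta_kernel_le hν ht) (norm_nonneg _) hM0

theorem aestronglyMeasurable_beta_kernel (N ν : ℂ) :
    AEStronglyMeasurable (fun t : ℝ => (t : ℂ) ^ ν * (1 - t : ℂ) ^ (N - ν))
      (volume.restrict (Set.Ioo 0 1)) := by
  refine ContinuousOn.aestronglyMeasurable (fun t ht => ?_) measurableSet_Ioo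
  have h1 : (t : ℂ) ∈ slitPlane := ofReal_mem_slitPlane.2 ht.1
  have h2 : (1 - t : ℂ) ∈ slitPlane := by
    rw [← ofReal_one, ← ofReal_sub]
    exact ofReal_mem_slitPlane.2 (by linarith [ht.2])
  refine ContinuousAt.continuousWithinAt (ContinuousAt.mul ?_ ?_)
  · exact ContinuousAt.cpow (by fun_prop) (by fun_prop) h1
  · exact ContinuousAt.cpow (by fun_prop) (by fun_prop) h2

theorem aestronglyMeasurable_eulerKernel (N ν : ℂ) {w : ℂ} (hw : w ∈ cutPlane) :
    AEStronglyMeasurable (eulerKernel N ν w) (volume.restrict (Set.Ioo 0 1)) := by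
  refine (aestronglyMeasurable_beta_kernel N ν).mul ?_
  refine ContinuousOn.aestronglyMeasurable (fun t ht => ?_) measurableSet_Ioo
  have hcont : Continuous fun t : ℝ => 1 - w * (t : ℂ) := by fun_prop
  exact (ContinuousAt.cpow hcont.continuousAt (by fun_prop)
    (one_sub_mul_mem_slitPlane hw (Set.Ioo_subset_Icc_self ht))).continuousWithinAt

theorem differentiableOn_eulerIntegral (hν : ν ∈ Metric.ball (n : ℂ) (1 / 2)) :
    DifferentiableOn ℂ (eulerIntegral (n + 1) ν) cutPlane := by
  intro w hw
  obtain ⟨r, hr, hrU⟩ := Metric.nhds_basis_closedBall.mem_iff.1 (isOpen_cutPlane.mem_nhds hw)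
  obtain ⟨M, -, hM⟩ := exists_norm_eulerKernel_le (n := n) hrU (isCompact_closedBall w r)
  refine (DifferentiableAt.const_mul ?_ _).differentiableWithinAt
  refine differentiableAt_integral_of_norm_le hr (bound := fun t => M * t ^ (-(1 / 2) : ℝ))
    (fun x hx => aestronglyMeasurable_eulerKernel _ _ (hrU (Metric.ball_subset_closedBall hx)))
    ?_ ?_ (integrableOn_rpow_neg_half.const_mul M)
  · filter_upwards [ae_restrict_mem measurableSet_Ioo] with t ht x hx
    have := one_sub_mul_mem_slitPlane (hrU (Metric.ball_subset_closedBall hx))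
      (Set.Ioo_subset_Icc_self ht)
    refine DifferentiableAt.differentiableWithinAt (DifferentiableAt.const_mul ?_ _)
    exact DifferentiableAt.cpow (by fun_prop) (by fun_prop) this
  · filter_upwards [ae_restrict_mem measurableSet_Ioo] with t ht x hx
    exact hM ν hν x (Metric.ball_subset_closedBall hx) t ht

theorem differentiableOn_eulerIntegral_param {w : ℂ} (hw : w ∈ cutPlane) :
    DifferentiableOn ℂ (fun ν => eulerIntegral (n + 1) ν w) (Metric.ball (n : ℂ) (1 / 2)) := by
  intro ν hν
  obtain ⟨r, hr, hrU⟩ := Metric.isOpen_iff.1 Metric.isOpen_ball ν hν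
  obtain ⟨M, -, hM⟩ := exists_norm_eulerKernel_le (n := n) (Set.singleton_subset_iff.2 hw)
    isCompact_singleton
  refine DifferentiableAt.differentiableWithinAt
    (DifferentiableAt.mul (DifferentiableAt.mul ?_ ?_) ?_)
  · exact (differentiable_one_div_Gamma _).comp ν (by fun_prop)
  · exact (differentiable_one_div_Gamma _).comp ν (by fun_prop)
  refine differentiableAt_integral_of_norm_le hr (bound := fun t => M * t ^ (-(1 / 2) : ℝ))
    (fun x hx => aestronglyMeasurable_eulerKernel _ _ hw)
    ?_ ?_ (integrableOn_rpow_neg_half.const_mul M)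
  · filter_upwards [ae_restrict_mem measurableSet_Ioo] with t ht x hx
    have h1 : (t : ℂ) ∈ slitPlane := ofReal_mem_slitPlane.2 ht.1
    have h2 : (1 - t : ℂ) ∈ slitPlane := by
      rw [← ofReal_one, ← ofReal_sub]
      exact ofReal_mem_slitPlane.2 (by linarith [ht.2])
    have h3 := one_sub_mul_mem_slitPlane hw (Set.Ioo_subset_Icc_self ht)
    refine DifferentiableAt.differentiableWithinAt
      (DifferentiableAt.mul (DifferentiableAt.mul ?_ ?_) ?_)
    · exact DifferentiableAt.cpow (by fun_prop) (by fun_prop) h1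
    · exact DifferentiableAt.cpow (by fun_prop) (by fun_prop) h2
    · exact DifferentiableAt.cpow (by fun_prop) (by fun_prop) h3
  · filter_upwards [ae_restrict_mem measurableSet_Ioo] with t ht x hx
    exact hM x (hrU hx) w rfl t ht

theorem exists_norm_eulerIntegral_le {K : Set ℂ} (hK : K ⊆ cutPlane) (hKc : IsCompact K) :
    ∃ M, ∀ ν ∈ Metric.ball (n : ℂ) (1 / 2), ∀ w ∈ K, ‖eulerIntegral (n + 1) ν w‖ ≤ M := by
  obtain ⟨M, hM0, hM⟩ := exists_norm_eulerKernel_le (n := n) hK hKc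
  have hc : Continuous fun ν : ℂ => (Gamma (ν + 1))⁻¹ * (Gamma (n + 1 + 1 - ν))⁻¹ :=
    (differentiable_one_div_Gamma.continuous.comp (by fun_prop)).mul
      (differentiable_one_div_Gamma.continuous.comp (by fun_prop))
  obtain ⟨A, hA⟩ := (isCompact_closedBall (n : ℂ) (1 / 2)).exists_bound_of_continuousOn
    hc.continuousOn
  refine ⟨|A| * ∫ t in Set.Ioo (0 : ℝ) 1, M * t ^ (-(1 / 2) : ℝ), fun ν hν w hw => ?_⟩
  rw [eulerIntegral, norm_mul]
  refine mul_le_mul ((hA ν (Metric.ball_subset_closedBall hν)).trans (le_abs_self A)) ?_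
    (norm_nonneg _) (abs_nonneg A)
  refine norm_integral_le_of_norm_le (integrableOn_rpow_neg_half.const_mul M) ?_
  filter_upwards [ae_restrict_mem measurableSet_Ioo] with t ht using hM ν hν w hw t ht

/-- Expand `(1 - w * t) ^ ν` binomially and integrate term by term. Each term is a Beta integral,
and its Gamma quotient cancels the prefactors. -/
theorem isPowerSum_eulerIntegral (hν : ν ∈ Metric.ball (n : ℂ) (1 / 2)) :
    IsPowerSum (eulerIntegral (n + 1) ν)
      fun k => (regularizedGaussHGFunSeries (-ν) (ν + 1) (n + 1 + 2)).coeff k := by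
  intro w hw
  obtain ⟨hre1, hre2⟩ := re_bounds_of_mem_ball hν
  set B : ℝ → ℂ := fun t => (t : ℂ) ^ ν * (1 - t : ℂ) ^ ((n + 1 : ℂ) - ν) with hB
  have hBi : IntegrableOn B (Set.Ioo 0 1) := by
    refine integrableOn_rpow_neg_half.mono' (aestronglyMeasurable_beta_kernel _ _) ?_
    filter_upwards [ae_restrict_mem measurableSet_Ioo] with t ht using norm_beta_kernel_le hν ht
  set d : ℕ → ℂ := fun k => (ascPochhammer ℂ k).eval (-ν) / k.factorial * w ^ k with hd
  set F : ℕ → ℝ → ℂ := fun k t => B t * (d k * (t : ℂ) ^ k) with hF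
  have hFle : ∀ k, ∀ t ∈ Set.Ioo (0 : ℝ) 1, ‖F k t‖ ≤ ‖d k‖ * ‖B t‖ := fun k t ht => by
    have : ‖(t : ℂ) ^ k‖ ≤ 1 := by
      rw [norm_pow, norm_real, Real.norm_of_nonneg ht.1.le]
      exact pow_le_one₀ ht.1.le ht.2.le
    simp only [hF, norm_mul]
    nlinarith [mul_le_mul_of_nonneg_left this (mul_nonneg (norm_nonneg (B t)) (norm_nonneg (d k)))]
  have hFi : ∀ k, Integrable (F k) (volume.restrict (Set.Ioo 0 1)) := fun k => by
    refine (hBi.norm.const_mul ‖d k‖).mono' ?_ ?_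
    · exact hBi.aestronglyMeasurable.mul (by fun_prop)
    · filter_upwards [ae_restrict_mem measurableSet_Ioo] with t ht using hFle k t ht
  have hds : Summable fun k => ‖d k‖ := (isPowerSum_one_sub_cpow ν w hw).summable.norm
  have hFs : Summable fun k => ∫ t in Set.Ioo (0 : ℝ) 1, ‖F k t‖ := by
    refine Summable.of_nonneg_of_le (fun k => integral_nonneg fun t => norm_nonneg _) (fun k => ?_)
      (hds.mul_right (∫ t in Set.Ioo (0 : ℝ) 1, ‖B t‖))
    rw [← integral_const_mul]
    refine integral_mono_ae (hFi k).norm (hBi.norm.const_mul _) ?_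
    filter_upwards [ae_restrict_mem measurableSet_Ioo] with t ht using hFle k t ht
  have hsum := hasSum_integral_of_summable_integral_norm hFi hFs
  have hker : ∫ t in Set.Ioo (0 : ℝ) 1, ∑' k, F k t =
      ∫ t in Set.Ioo (0 : ℝ) 1, eulerKernel (n + 1) ν w t := by
    refine setIntegral_congr_fun measurableSet_Ioo fun t ht => ?_
    have hwt : w * t ∈ Metric.ball (0 : ℂ) 1 := by
      rw [mem_ball_zero_iff] at hw ⊢
      rw [norm_mul, norm_real, Real.norm_of_nonneg ht.1.le]
      nlinarith [norm_nonneg w, ht.1, ht.2]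
    have := ((isPowerSum_one_sub_cpow ν (w * t) hwt).mul_left (B t)).tsum_eq
    simp only [eulerKernel, hB] at this ⊢
    rw [← this]
    refine tsum_congr fun k => ?_
    simp only [hF, hd, hB, mul_pow]
    ring
  rw [hker] at hsum
  have hmul := hsum.mul_left ((Gamma (ν + 1))⁻¹ * (Gamma (n + 1 + 1 - ν))⁻¹)
  refine hmul.congr_fun fun k => ?_
  have hint : ∫ t in Set.Ioo (0 : ℝ) 1, F k t =
      d k * betaIntegral (ν + 1 + k) (n + 1 + 1 - ν) := by
    rw [betaIntegral, intervalIntegral.integral_of_le zero_le_one, integral_Ioc_eq_integral_Ioo,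
      ← integral_const_mul]
    refine setIntegral_congr_fun measurableSet_Ioo fun t ht => ?_
    have ht0 : (t : ℂ) ≠ 0 := by exact_mod_cast ht.1.ne'
    simp only [hF, hB]
    rw [show ν + 1 + k - 1 = ν + k by ring, cpow_add _ _ ht0, cpow_natCast,
      show (n + 1 + 1 - ν - 1 : ℂ) = n + 1 - ν by ring]
    ring
  have hg := Gamma_mul_Gamma_eq_betaIntegral (s := ν + 1 + k) (t := n + 1 + 1 - ν)
    (by simp; linarith [k.cast_nonneg (α := ℝ)]) (by simp; linarith)
  have hG1 : Gamma (n + 1 + 1 - ν) ≠ 0 := Gamma_ne_zero_of_re_pos (by simp; linarith)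
  have hν1 : ∀ j : ℕ, ν + 1 ≠ -j := fun j hj => by
    have := congrArg re hj
    simp at this
    linarith [j.cast_nonneg (α := ℝ)]
  have hG2 : Gamma (ν + 1) ≠ 0 := Gamma_ne_zero hν1
  have hG3 : Gamma ((n : ℂ) + 1 + 2 + k) ≠ 0 := Gamma_ne_zero_of_re_pos (by simp; positivity)
  have hpoch := Gamma_add_nat_div_Gamma_eq (n := k) (ν + 1) hν1
  rw [show ν + 1 + k + (n + 1 + 1 - ν) = n + 1 + 2 + k by ring] at hg
  have hk : (k.factorial : ℂ) ≠ 0 := by exact_mod_cast k.factorial_ne_zero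
  rw [hint]
  simp only [hd, coeff_regularizedGaussHGFunSeries, ← hpoch]
  field_simp
  linear_combination (w ^ k * (ascPochhammer ℂ k).eval (-ν)) * hg

end EulerIntegral

/-! ### Continuation to the cut plane, differentiable in the degree -/

section Continuation

open Filter Topology

theorem exists_family_lower {a b : ℂ → ℂ} {c x₀ : ℂ}
    (h : ∃ F G, HasLocUnifDerivAt F G x₀ cutPlane ∧ ∀ᶠ x in 𝓝 x₀,
      IsPowerSum (F x) fun k => (regularizedGaussHGFunSeries (a x) (b x) (c + 1)).coeff k) :
    ∃ F G, HasLocUnifDerivAt F G x₀ cutPlane ∧ ∀ᶠ x in 𝓝 x₀,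
      IsPowerSum (F x) fun k => (regularizedGaussHGFunSeries (a x) (b x) c).coeff k := by
  obtain ⟨F, G, hF, hp⟩ := h
  refine ⟨_, _, hF.add_const_mul_deriv isOpen_cutPlane c, hp.mono fun x hx => ?_⟩
  convert hx.lower c using 2 with k
  have h := one_div_Gamma_eq_self_mul_one_div_Gamma_add_one (c + k)
  simp only [coeff_regularizedGaussHGFunSeries, div_eq_mul_inv, mul_inv]
  rw [h, show c + 1 + k = c + k + 1 by ring]
  ring

theorem exists_family_lower_nat {a b : ℂ → ℂ} {c x₀ : ℂ} (j : ℕ)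
    (h : ∃ F G, HasLocUnifDerivAt F G x₀ cutPlane ∧ ∀ᶠ x in 𝓝 x₀,
      IsPowerSum (F x) fun k => (regularizedGaussHGFunSeries (a x) (b x) (c + j)).coeff k) :
    ∃ F G, HasLocUnifDerivAt F G x₀ cutPlane ∧ ∀ᶠ x in 𝓝 x₀,
      IsPowerSum (F x) fun k => (regularizedGaussHGFunSeries (a x) (b x) c).coeff k := by
  induction j with
  | zero => simpa using h
  | succ j ih =>
    refine ih (exists_family_lower ?_)
    simpa only [Nat.cast_succ, add_assoc] using h

/-- Near `ν = n` the series `₂F₁(-ν, ν + 1; 1 + m; ·)` continues to the cut plane, differentiably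
in `ν`. -/
theorem exists_family {m n : ℕ} (hmn : m ≤ n) :
    ∃ F G, HasLocUnifDerivAt F G (n : ℂ) cutPlane ∧ ∀ᶠ ν in 𝓝 (n : ℂ),
      IsPowerSum (F ν) fun k => (regularizedGaussHGFunSeries (-ν) (ν + 1) (1 + m)).coeff k := by
  -- The number of lowerings from `c = n + 3`, where Euler's integral is available, to `c = 1 + m`.
  refine exists_family_lower_nat (n - m + 2) ?_
  have e : (1 + m + (n - m + 2 : ℕ) : ℂ) = n + 1 + 2 := by
    push_cast [Nat.cast_sub hmn]
    ring
  rw [e]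
  refine ⟨eulerIntegral (n + 1), _, .of_bounded isOpen_cutPlane (r := 1 / 2) (by norm_num)
    (fun ν hν => differentiableOn_eulerIntegral hν)
    (fun w hw => differentiableOn_eulerIntegral_param hw)
    (fun K hK hKc => exists_norm_eulerIntegral_le hK hKc), ?_⟩
  filter_upwards [Metric.ball_mem_nhds (n : ℂ) (ε := 1 / 2) (by norm_num)] with ν hν
  exact isPowerSum_eulerIntegral hν

end Continuation

/-! ### Digamma derivatives and terminating series -/

theorem IsPowerSum.sub {f g : ℂ → ℂ} {p q : ℕ → ℂ} (hf : IsPowerSum f p) (hg : IsPowerSum g q) :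
    IsPowerSum (fun w => f w - g w) fun k => p k - q k := fun w hw => by
  simpa only [sub_mul] using (hf w hw).sub (hg w hw)

theorem gaussHG_eq {a b c : ℂ} {f : ℂ → ℂ} (hf : IsGaussContinuation a b c f) {w : ℂ}
    (hw : w ∈ cutPlane) : gaussHG a b c w = f w := by
  have h : ∃ f, IsGaussContinuation a b c f := ⟨f, hf⟩
  rw [gaussHG, dif_pos h]
  exact h.choose_spec.eqOn hf hw

theorem add_nat_ne_neg_nat {x : ℂ} (hx : ∀ j : ℕ, x ≠ -j) (k : ℕ) : ∀ j : ℕ, x + k ≠ -j :=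
  fun j hj => hx (j + k) (by push_cast; linear_combination hj)

theorem natCast_add_one_ne_neg_nat (N : ℕ) : ∀ j : ℕ, (N : ℂ) + 1 ≠ -j := fun j hj => by
  have : ((N + 1 + j : ℕ) : ℂ) = 0 := by push_cast; linear_combination hj
  exact absurd (Nat.cast_eq_zero.1 this) (by omega)

theorem hasDerivAt_Gamma_digamma {x : ℂ} (hx : ∀ j : ℕ, x ≠ -j) :
    HasDerivAt Gamma (Gamma x * digamma x) x := by
  have h := (differentiableAt_Gamma x hx).hasDerivAt
  have e : Gamma x * digamma x = deriv Gamma x := by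
    rw [digamma_def, logDeriv_apply, mul_div_cancel₀ _ (Gamma_ne_zero hx)]
  rwa [e]

theorem hasDerivAt_inv_Gamma {x : ℂ} (hx : ∀ j : ℕ, x ≠ -j) :
    HasDerivAt (fun x => (Gamma x)⁻¹) (-((Gamma x)⁻¹ * digamma x)) x := by
  have h0 := Gamma_ne_zero hx
  refine ((hasDerivAt_Gamma_digamma hx).inv h0).congr_deriv ?_
  field_simp

/-- Logarithmic differentiation of `(x)_k = Γ(x + k) / Γ(x)`. -/
theorem hasDerivAt_ascPochhammer_eval (k : ℕ) {x : ℂ} (hx : ∀ j : ℕ, x ≠ -j) :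
    HasDerivAt (fun x => (ascPochhammer ℂ k).eval x)
      ((ascPochhammer ℂ k).eval x * (digamma (x + k) - digamma x)) x := by
  have h1 : HasDerivAt (fun x => Gamma (x + k)) (Gamma (x + k) * digamma (x + k)) x :=
    (hasDerivAt_Gamma_digamma (add_nat_ne_neg_nat hx k)).comp_add_const x k
  have h2 := h1.mul (hasDerivAt_inv_Gamma hx)
  have h3 : ∀ᶠ y in nhds x, (ascPochhammer ℂ k).eval y = Gamma (y + k) * (Gamma y)⁻¹ := by
    have : ∀ᶠ y in nhds x, (Gamma y) ≠ 0 :=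
      (differentiableAt_Gamma x hx).continuousAt.eventually_ne (Gamma_ne_zero hx)
    filter_upwards [this] with y hy
    rw [← Gamma_add_nat_div_Gamma_eq y fun j hj => hy (hj ▸ Gamma_neg_nat_eq_zero j),
      div_eq_mul_inv]
  refine (h2.congr_of_eventuallyEq h3).congr_deriv ?_
  rw [h3.self_of_nhds]
  ring

theorem ascPochhammer_eval_neg_natCast {N k : ℕ} (h : k ≤ N) :
    (ascPochhammer ℂ k).eval (-(N : ℂ)) = (-1) ^ k * (N.factorial / (N - k).factorial) := by
  rw [ascPochhammer_eval_neg_eq_descPochhammer, descPochhammer_eval_eq_descFactorial]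
  congr 1
  have h1 : ((N - k).factorial : ℂ) ≠ 0 := by exact_mod_cast (N - k).factorial_ne_zero
  rw [eq_div_iff h1, mul_comm]
  exact_mod_cast Nat.factorial_mul_descFactorial h

theorem ascPochhammer_eval_natCast_add_one (N k : ℕ) :
    (ascPochhammer ℂ k).eval (N + 1 : ℂ) = (N + k).factorial / N.factorial := by
  have h1 : (N.factorial : ℂ) ≠ 0 := by exact_mod_cast N.factorial_ne_zero
  rw [eq_div_iff h1, mul_comm]
  have := factorial_mul_ascPochhammer ℂ N k
  exact this

theorem ascPochhammer_eval_neg_mul (m : ℕ) (ν : ℂ) :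
    (ascPochhammer ℂ m).eval (-ν) * (ascPochhammer ℂ m).eval (ν + 1) =
      (-1) ^ m * (ascPochhammer ℂ (m + m)).eval (ν - m + 1) := by
  rw [ascPochhammer_eval_neg_eq_descPochhammer, descPochhammer_eval_eq_ascPochhammer,
    ascPochhammer_eval_add]
  rw [show ν - m + 1 + m = ν + 1 by ring]
  ring

theorem isPowerSum_polynomial (s : Finset ℕ) (p : ℕ → ℂ) (h : ∀ k ∉ s, p k = 0) :
    IsPowerSum (fun w => ∑ k ∈ s, p k * w ^ k) p := fun w _ =>
  hasSum_sum_of_ne_finset_zero fun k hk => by rw [h k hk, zero_mul]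

theorem coeff_regularizedGaussHGFunSeries_neg_nat {N k : ℕ} (h : N < k) (b c : ℂ) :
    (regularizedGaussHGFunSeries (-N) b c).coeff k = 0 := by
  rw [coeff_regularizedGaussHGFunSeries, ascPochhammer_eval_neg_coe_nat_of_lt h]
  simp

theorem regularizedGaussHGFun_neg_nat (N : ℕ) (b c : ℂ) {w : ℂ} (hw : w ∈ Metric.ball (0 : ℂ) 1) :
    regularizedGaussHGFun (-N) b c w =
      ∑ k ∈ Finset.range (N + 1), (regularizedGaussHGFunSeries (-N) b c).coeff k * w ^ k :=
  (isPowerSum_regularizedGaussHGFun _ b c).eq (isPowerSum_polynomial _ _ fun k hk =>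
    coeff_regularizedGaussHGFunSeries_neg_nat (by simpa using hk) b c) rfl hw

/-! ### The two closed-form families and the derivative in the degree -/

section Families

open Filter Topology

variable (m n : ℕ)

/-- The coefficients along `ν = n`, `μ = m + ε`. -/
noncomputable def orderCoeff (ε : ℂ) (k : ℕ) : ℂ :=
  (ascPochhammer ℂ k).eval (-(n : ℂ)) * (ascPochhammer ℂ k).eval (n + 1 : ℂ) / k.factorial *
    (Gamma (1 + (m + ε) + k))⁻¹

/-- The coefficients, after Euler's transformation, along `ν = n + ε`, `μ = m + ε`. -/
noncomputable def diagCoeff (ε : ℂ) (k : ℕ) : ℂ :=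
  (ascPochhammer ℂ k).eval (-((n - m : ℕ) : ℂ)) *
    (ascPochhammer ℂ k).eval (m + n + 1 + 2 * ε : ℂ) / k.factorial *
    (Gamma (1 + (m + ε) + k))⁻¹

/-- `₂F₁(-n, n + 1; 1 + m + ε; w)` as a polynomial in `w`. -/
noncomputable def orderFamily (ε w : ℂ) : ℂ :=
  ∑ k ∈ Finset.range (n + 1), orderCoeff m n ε k * w ^ k

/-- `₂F₁(-n - ε, n + ε + 1; 1 + m + ε; w)` in closed form. -/
noncomputable def diagFamily (ε w : ℂ) : ℂ :=
  (1 - w) ^ (m + ε) * ∑ k ∈ Finset.range (n - m + 1), diagCoeff m n ε k * w ^ k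

theorem differentiable_orderCoeff (k : ℕ) : Differentiable ℂ fun ε => orderCoeff m n ε k :=
  (differentiable_one_div_Gamma.comp (by fun_prop)).const_mul _

theorem differentiable_diagCoeff (k : ℕ) : Differentiable ℂ fun ε => diagCoeff m n ε k := by
  have h : Differentiable ℂ fun ε : ℂ => (ascPochhammer ℂ k).eval (m + n + 1 + 2 * ε : ℂ) :=
    (ascPochhammer ℂ k).differentiable.comp (by fun_prop)
  exact ((h.const_mul _).div_const _).mul (differentiable_one_div_Gamma.comp (by fun_prop))

theorem hasLocUnifDerivAt_orderFamily :
    HasLocUnifDerivAt (orderFamily m n)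
      (fun w => deriv (fun ε => orderFamily m n ε w) 0) 0 cutPlane := by
  refine .of_continuousOn isOpen_cutPlane one_pos (fun ε _ => ?_) (fun w _ => ?_) ?_
  · unfold orderFamily
    fun_prop
  · exact (Differentiable.fun_sum fun k _ =>
      (differentiable_orderCoeff m n k).mul_const _).differentiableOn
  · refine (continuous_finsetSum _ fun k _ => ?_).continuousOn
    exact ((differentiable_orderCoeff m n k).continuous.comp continuous_fst).mul (by fun_prop)

theorem hasLocUnifDerivAt_diagFamily :
    HasLocUnifDerivAt (diagFamily m n)
      (fun w => deriv (fun ε => diagFamily m n ε w) 0) 0 cutPlane := by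
  refine .of_continuousOn isOpen_cutPlane one_pos (fun ε _ => ?_) (fun w hw => ?_) ?_
  · refine DifferentiableOn.mul (fun w hw => ?_) (by fun_prop)
    have h1 : DifferentiableAt ℂ (fun w : ℂ => 1 - w) w := by fun_prop
    exact (h1.cpow (differentiableAt_const _) hw).differentiableWithinAt
  · refine DifferentiableOn.mul (fun ε _ => ?_) ?_
    · have h1 : DifferentiableAt ℂ (fun ε : ℂ => m + ε) ε := by fun_prop
      exact ((differentiableAt_const _).cpow h1 hw).differentiableWithinAt
    · exact (Differentiable.fun_sum fun k _ =>
        (differentiable_diagCoeff m n k).mul_const _).differentiableOn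
  · refine ContinuousOn.mul (ContinuousOn.cpow (by fun_prop) (by fun_prop) fun q hq => hq.2) ?_
    refine (continuous_finsetSum _ fun k _ => ?_).continuousOn
    exact ((differentiable_diagCoeff m n k).continuous.comp continuous_fst).mul (by fun_prop)

theorem isPowerSum_orderFamily (ε : ℂ) : IsPowerSum (orderFamily m n ε) (orderCoeff m n ε) := by
  refine isPowerSum_polynomial _ _ fun k hk => ?_
  rw [orderCoeff, ascPochhammer_eval_neg_coe_nat_of_lt (by simpa using hk)]
  simp

variable {m n}

/-- Here `c - b = -(n - m)` does not depend on `ε`, so Euler's transform terminates. The other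
parameters are `c - a - b = m + ε` and `c - a = m + n + 1 + 2 * ε`, the source of the factor `2`
before the digamma. -/
theorem isPowerSum_diagFamily (hmn : m ≤ n) {ε : ℂ} (hε : ∀ k : ℕ, 1 + (m + ε) ≠ -k) :
    IsPowerSum (diagFamily m n ε)
      fun k => (regularizedGaussHGFunSeries (-(n + ε)) (n + ε + 1) (1 + (m + ε))).coeff k := by
  intro w hw
  have h := isPowerSum_regularizedGaussHGFun (-(n + ε)) (n + ε + 1) (1 + (m + ε)) w hw
  rw [regularizedGaussHGFun_euler _ _ hε hw] at h
  rw [show 1 + (m + ε) - -(n + ε) - (n + ε + 1) = m + ε by ring,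
    show 1 + (m + ε) - (n + ε + 1) = -((n - m : ℕ) : ℂ) by push_cast [Nat.cast_sub hmn]; ring,
    regularizedGaussHGFun_symm, regularizedGaussHGFun_neg_nat _ _ _ hw] at h
  convert h using 1
  unfold diagFamily diagCoeff
  congr 1
  refine Finset.sum_congr rfl fun k _ => ?_
  rw [coeff_regularizedGaussHGFunSeries,
    show 1 + (m + ε) - -(n + ε) = m + n + 1 + 2 * ε by ring, div_mul_eq_div_div, ← div_eq_mul_inv]

theorem one_add_ne_neg_nat_of_mem_ball {ε : ℂ} (hε : ε ∈ Metric.ball (0 : ℂ) 1) (k : ℕ) :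
    1 + (m + ε) ≠ -k := by
  intro h
  have h1 := congrArg re h
  have h2 := (abs_lt.1 ((abs_re_le_norm ε).trans_lt (mem_ball_zero_iff.1 hε))).1
  simp at h1
  linarith [m.cast_nonneg (α := ℝ), k.cast_nonneg (α := ℝ)]

theorem hasDerivAt_one_add_inv_Gamma (k : ℕ) :
    HasDerivAt (fun ε : ℂ => (Gamma (1 + (m + ε) + k))⁻¹)
      (-((Gamma (1 + (m + 0) + k))⁻¹ * digamma (k + m + 1))) 0 := by
  have h : ∀ j : ℕ, (1 + (m + 0) + k : ℂ) ≠ -j := by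
    have := natCast_add_one_ne_neg_nat (m + k)
    push_cast at this
    intro j
    convert this j using 1
    ring
  have hl : HasDerivAt (fun ε : ℂ => 1 + (m + ε) + k) 1 0 :=
    (((hasDerivAt_id (0 : ℂ)).const_add (m : ℂ)).const_add 1).add_const (k : ℂ)
  refine ((hasDerivAt_inv_Gamma h).comp (0 : ℂ) hl).congr_deriv ?_
  rw [mul_one, show (1 + (m + 0) + k : ℂ) = k + m + 1 by ring]

theorem hasDerivAt_orderCoeff (k : ℕ) :
    HasDerivAt (fun ε => orderCoeff m n ε k) (-(orderCoeff m n 0 k * digamma (k + m + 1))) 0 := by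
  refine ((hasDerivAt_one_add_inv_Gamma k).const_mul _).congr_deriv ?_
  rw [orderCoeff]
  ring

theorem hasDerivAt_diagCoeff (k : ℕ) :
    HasDerivAt (fun ε => diagCoeff m n ε k)
      (diagCoeff m n 0 k * (2 * digamma (k + n + m + 1) - digamma (k + m + 1))
        - 2 * digamma (n + m + 1) * diagCoeff m n 0 k) 0 := by
  have h : ∀ j : ℕ, (m + n + 1 + 2 * 0 : ℂ) ≠ -j := by
    have := natCast_add_one_ne_neg_nat (m + n)
    push_cast at this
    simpa using this
  have hl : HasDerivAt (fun ε : ℂ => (m + n + 1 + 2 * ε : ℂ)) (2 * 1) 0 :=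
    ((hasDerivAt_id (0 : ℂ)).const_mul 2).const_add _
  have h1 := (hasDerivAt_ascPochhammer_eval k h).comp (0 : ℂ) hl
  refine (((h1.const_mul _).div_const _).mul (hasDerivAt_one_add_inv_Gamma k)).congr_deriv ?_
  simp only [diagCoeff, Function.comp_apply]
  rw [show (m + n + 1 + 2 * 0 + k : ℂ) = k + n + m + 1 by ring,
    show (n + m + 1 : ℂ) = m + n + 1 + 2 * 0 by ring]
  ring

/-- The derivative in `ν` at `n` of `₂F₁(-ν, ν + 1; 1 + m; ·)` is the derivative along
`(ν, μ) = (n + ε, m + ε)` minus the one along `(n, m + ε)`. -/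
theorem eqOn_deriv_family (hmn : m ≤ n) {F : ℂ → ℂ → ℂ} {G : ℂ → ℂ}
    (hF : HasLocUnifDerivAt F G (n : ℂ) cutPlane)
    (hp : ∀ᶠ ν in 𝓝 (n : ℂ),
      IsPowerSum (F ν) fun k => (regularizedGaussHGFunSeries (-ν) (ν + 1) (1 + m)).coeff k) :
    Set.EqOn G (fun w => deriv (fun ε => diagFamily m n ε w) 0 -
      deriv (fun ε => orderFamily m n ε w) 0) cutPlane := by
  -- Each coefficient is a function of `ν` times a function of `μ`, so the chain rule reduces to the
  -- product rule.
  set A : ℕ → ℂ → ℂ := fun k ν =>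
    (ascPochhammer ℂ k).eval (-ν) * (ascPochhammer ℂ k).eval (ν + 1) / k.factorial with hA
  have hAd : ∀ k, Differentiable ℂ (A k) := fun k =>
    (((ascPochhammer ℂ k).differentiable.comp (by fun_prop)).mul
      ((ascPochhammer ℂ k).differentiable.comp (by fun_prop))).div_const _
  set B : ℕ → ℂ → ℂ := fun k μ => (Gamma (1 + μ + k))⁻¹ with hB
  have hBd : ∀ k, Differentiable ℂ fun ε => B k (m + ε) := fun k =>
    differentiable_one_div_Gamma.comp (by fun_prop)
  have hq : ∀ ν μ k, (regularizedGaussHGFunSeries (-ν) (ν + 1) (1 + μ)).coeff k =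
      A k ν * B k μ := fun ν μ k => by
    rw [coeff_regularizedGaussHGFunSeries, div_mul_eq_div_div, div_eq_mul_inv _ (Gamma _)]
  have hG : IsPowerSum G fun k => deriv (A k) n * B k m := by
    refine (hF.mono ball_subset_cutPlane).isPowerSum hp fun k => ?_
    simp only [hq]
    exact (hAd k _).hasDerivAt.mul_const _
  have hdiag := ((hasLocUnifDerivAt_diagFamily m n).mono ball_subset_cutPlane).isPowerSum
    (p := fun ε k => A k (n + ε) * B k (m + ε))
    (p' := fun k => deriv (A k) n * B k m + A k n * deriv (fun ε => B k (m + ε)) 0) (by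
      filter_upwards [Metric.ball_mem_nhds (0 : ℂ) one_pos] with ε hε
      simpa only [hq] using isPowerSum_diagFamily hmn (one_add_ne_neg_nat_of_mem_ball hε))
    fun k => by
      have h1 : HasDerivAt (fun ε : ℂ => A k (n + ε)) (deriv (A k) n) 0 := by
        have := (hAd k (n + 0)).hasDerivAt.comp_const_add (n : ℂ) 0
        simpa using this
      refine (h1.mul (hBd k 0).hasDerivAt).congr_deriv ?_
      simp only [add_zero]
  have horder := ((hasLocUnifDerivAt_orderFamily m n).mono ball_subset_cutPlane).isPowerSum
    (p := fun ε k => A k n * B k (m + ε))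
    (p' := fun k => A k n * deriv (fun ε => B k (m + ε)) 0)
    (.of_forall fun ε => isPowerSum_orderFamily m n ε)
    fun k => (hBd k 0).hasDerivAt.const_mul _
  refine eqOn_cutPlane (hF.differentiableOn isOpen_cutPlane)
    (((hasLocUnifDerivAt_diagFamily m n).differentiableOn isOpen_cutPlane).sub
      ((hasLocUnifDerivAt_orderFamily m n).differentiableOn isOpen_cutPlane)) fun w hw => ?_
  refine hG.eq (hdiag.sub horder) ?_ hw
  funext k
  ring

theorem deriv_orderFamily (w : ℂ) :
    deriv (fun ε => orderFamily m n ε w) 0 =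
      -∑ k ∈ Finset.range (n + 1), orderCoeff m n 0 k * digamma (k + m + 1) * w ^ k := by
  have h := HasDerivAt.fun_sum fun k (_ : k ∈ Finset.range (n + 1)) =>
    (hasDerivAt_orderCoeff (m := m) (n := n) k).mul_const (w ^ k)
  refine h.deriv.trans ?_
  rw [← Finset.sum_neg_distrib]
  exact Finset.sum_congr rfl fun k _ => by ring

theorem deriv_diagFamily {w : ℂ} (hw : w ∈ cutPlane) :
    deriv (fun ε => diagFamily m n ε w) 0 =
      log (1 - w) * diagFamily m n 0 w - 2 * digamma (n + m + 1) * diagFamily m n 0 w +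
      (1 - w) ^ m * ∑ k ∈ Finset.range (n - m + 1),
        diagCoeff m n 0 k * (2 * digamma (k + n + m + 1) - digamma (k + m + 1)) * w ^ k := by
  have h := HasDerivAt.fun_sum fun k (_ : k ∈ Finset.range (n - m + 1)) =>
    (hasDerivAt_diagCoeff (m := m) (n := n) k).mul_const (w ^ k)
  have hl : HasDerivAt (fun ε : ℂ => m + ε) 1 0 := (hasDerivAt_id (0 : ℂ)).const_add (m : ℂ)
  have h2 := (hl.const_cpow (c := 1 - w) (.inl (slitPlane_ne_zero hw))).mul h
  refine h2.deriv.trans ?_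
  simp only [diagFamily, sub_mul, Finset.sum_sub_distrib, add_zero, cpow_natCast, mul_assoc,
    ← Finset.mul_sum]
  ring

theorem family_eq_diagFamily (hmn : m ≤ n) {f : ℂ → ℂ} (hf : DifferentiableOn ℂ f cutPlane)
    (hp : IsPowerSum f fun k => (regularizedGaussHGFunSeries (-n) (n + 1) (1 + m)).coeff k) :
    Set.EqOn f (diagFamily m n 0) cutPlane := by
  refine eqOn_cutPlane hf
    (hasLocUnifDerivAt_diagFamily m n).eventually_differentiableOn.self_of_nhds fun w hw => ?_
  refine hp.eq (isPowerSum_diagFamily hmn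
    (one_add_ne_neg_nat_of_mem_ball (Metric.mem_ball_self one_pos))) ?_ hw
  simp

/-- The `c = 1 - m` series is a multiple of `w ^ m` times the one with parameters `m - ν, ν + 1 + m;
1 + m`. Euler's transformation returns these to `-ν, ν + 1` at the cost of `(1 - w) ^ (-m)`. -/
theorem isGaussContinuation_one_sub_nat {ν : ℂ} {f : ℂ → ℂ} (hf : DifferentiableOn ℂ f cutPlane)
    (hp : IsPowerSum f fun k => (regularizedGaussHGFunSeries (-ν) (ν + 1) (1 + m)).coeff k) :
    IsGaussContinuation (-ν) (ν + 1) (1 - m) fun w =>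
      (-1) ^ m * (ascPochhammer ℂ (m + m)).eval (ν - m + 1) * w ^ m / (1 - w) ^ m * f w := by
  have h0 : ∀ w ∈ cutPlane, (1 - w) ^ m ≠ 0 := fun w hw => pow_ne_zero m (slitPlane_ne_zero hw)
  refine ⟨?_, fun w hw => ?_⟩
  · have : DifferentiableOn ℂ (fun w : ℂ =>
        (-1) ^ m * (ascPochhammer ℂ (m + m)).eval (ν - m + 1) * w ^ m / (1 - w) ^ m) cutPlane :=
      DifferentiableOn.div (by fun_prop) (by fun_prop) h0
    exact this.mul hf
  · have hm : ∀ k : ℕ, (1 + m : ℂ) ≠ -k := by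
      simpa [add_comm] using natCast_add_one_ne_neg_nat m
    beta_reduce
    rw [hp.eq (isPowerSum_regularizedGaussHGFun _ _ _) rfl hw,
      regularizedGaussHGFun_euler _ _ hm hw, regularizedGaussHGFun_one_sub_nat _ _ m hw,
      ascPochhammer_eval_neg_mul, show (1 + m - -ν - (ν + 1) : ℂ) = m by ring,
      show (1 + m - -ν : ℂ) = ν + 1 + m by ring, show (1 + m - (ν + 1) : ℂ) = -ν + m by ring,
      regularizedGaussHGFun_symm (ν + 1 + m), cpow_natCast]
    have := h0 w (ball_subset_cutPlane hw)
    field_simp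

theorem hasDerivAt_ascPochhammer_shift (hmn : m ≤ n) :
    HasDerivAt (fun ν : ℂ => (-1 : ℂ) ^ m * (ascPochhammer ℂ (m + m)).eval (ν - m + 1))
      ((-1) ^ m * (ascPochhammer ℂ (m + m)).eval (n - m + 1 : ℂ) *
        (digamma (n + m + 1) - digamma (n - m + 1))) n := by
  have h : ∀ j : ℕ, (n - m + 1 : ℂ) ≠ -j := by
    have := natCast_add_one_ne_neg_nat (n - m)
    rwa [Nat.cast_sub hmn] at this
  have hl : HasDerivAt (fun ν : ℂ => ν - m + 1) 1 (n : ℂ) :=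
    ((hasDerivAt_id (n : ℂ)).sub_const _).add_const _
  refine (((hasDerivAt_ascPochhammer_eval (m + m) h).comp (n : ℂ) hl).const_mul _).congr_deriv ?_
  push_cast
  rw [show (n - m + 1 + (m + m) : ℂ) = n + m + 1 by ring]
  ring

/-- The derivative in `ν` at `n ≥ m` of `₂F₁(-ν, ν + 1; 1 - m; w)`. -/
theorem gaussHG_natCast_and_hasDerivAt (hmn : m ≤ n) {w : ℂ} (hw : w ∈ cutPlane) :
    gaussHG (-n) (n + 1) (1 - m) w =
      (-1) ^ m * (ascPochhammer ℂ (m + m)).eval (n - m + 1 : ℂ) * w ^ m / (1 - w) ^ m *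
        diagFamily m n 0 w ∧
    HasDerivAt (fun ν : ℂ => gaussHG (-ν) (ν + 1) (1 - m) w)
      ((digamma (n + m + 1) - digamma (n - m + 1)) * gaussHG (-n) (n + 1) (1 - m) w +
        (-1) ^ m * (ascPochhammer ℂ (m + m)).eval (n - m + 1 : ℂ) * w ^ m / (1 - w) ^ m *
        (deriv (fun ε => diagFamily m n ε w) 0 - deriv (fun ε => orderFamily m n ε w) 0)) n := by
  obtain ⟨F, G, hF, hp⟩ := exists_family hmn
  have heq : ∀ᶠ ν in 𝓝 (n : ℂ), gaussHG (-ν) (ν + 1) (1 - m) w =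
      (-1) ^ m * (ascPochhammer ℂ (m + m)).eval (ν - m + 1) * w ^ m / (1 - w) ^ m * F ν w := by
    filter_upwards [hF.eventually_differentiableOn, hp] with ν h1 h2
    exact gaussHG_eq (isGaussContinuation_one_sub_nat h1 h2) hw
  have hFn := family_eq_diagFamily hmn hF.eventually_differentiableOn.self_of_nhds
    hp.self_of_nhds hw
  have hval := heq.self_of_nhds
  rw [hFn] at hval
  refine ⟨hval, ?_⟩
  have hd := (((hasDerivAt_ascPochhammer_shift hmn).mul_const (w ^ m)).div_const
    ((1 - w) ^ m)).mul (hF.hasDerivAt hw)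
  refine (hd.congr_of_eventuallyEq heq).congr_deriv ?_
  rw [hval, hFn, eqOn_deriv_family hmn hF hp hw]
  ring

end Families

/-! ### Half-integer powers, factorials and the final formula -/

/-- Division by a positive real leaves the argument unchanged, so the principal logarithms subtract.
-/
theorem div_two_cpow {x : ℂ} (hx : x ≠ 0) (s : ℂ) : (x / 2) ^ s = x ^ s / 2 ^ s := by
  have h2 : (2 : ℂ) ≠ 0 := two_ne_zero
  have hl : log (x / 2) = log x - log 2 := by
    have h := log_ofReal_mul (r := 2⁻¹) (by norm_num) hx
    rw [Real.log_inv, ofReal_neg, ofReal_inv, ofReal_ofNat, ofReal_log zero_le_two,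
      ofReal_ofNat] at h
    rw [div_eq_inv_mul, h]
    ring
  rw [cpow_def_of_ne_zero (div_ne_zero hx h2), cpow_def_of_ne_zero hx, cpow_def_of_ne_zero h2, hl,
    sub_mul, exp_sub]

theorem cpow_half_natCast_sq (x : ℂ) (m : ℕ) : (x ^ ((m : ℂ) / 2)) ^ 2 = x ^ m := by
  rw [← cpow_nat_mul, Nat.cast_ofNat, mul_div_cancel₀ _ two_ne_zero, cpow_natCast]

theorem ascPochhammer_eval_shift {m n : ℕ} (hmn : m ≤ n) :
    (ascPochhammer ℂ (m + m)).eval (n - m + 1 : ℂ) = (n + m).factorial / (n - m).factorial := by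
  have := ascPochhammer_eval_natCast_add_one (n - m) (m + m)
  rwa [Nat.cast_sub hmn, show n - m + (m + m) = n + m by omega] at this

theorem inv_Gamma_one_add (m k : ℕ) :
    (Gamma (1 + (m + 0) + k : ℂ))⁻¹ = ((k + m).factorial : ℂ)⁻¹ := by
  rw [show (1 + (m + 0) + k : ℂ) = ((k + m : ℕ) : ℂ) + 1 by push_cast; ring,
    Gamma_nat_eq_factorial]

theorem factorial_mul_diagCoeff {m n k : ℕ} (hk : k ≤ n - m) :
    ((n + m).factorial / (n - m).factorial : ℂ) * diagCoeff m n 0 k =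
      (-1) ^ k * ((k + n + m).factorial /
        (k.factorial * (k + m).factorial * (n - m - k).factorial)) := by
  have h := ascPochhammer_eval_natCast_add_one (m + n) k
  push_cast at h
  rw [diagCoeff, inv_Gamma_one_add, mul_zero, add_zero, h, ascPochhammer_eval_neg_natCast hk,
    show m + n + k = k + n + m by omega, add_comm m n]
  have h1 : ((n + m).factorial : ℂ) ≠ 0 := by exact_mod_cast (n + m).factorial_ne_zero
  have h2 : ((n - m).factorial : ℂ) ≠ 0 := by exact_mod_cast (n - m).factorial_ne_zero
  have h3 : ((n - m - k).factorial : ℂ) ≠ 0 := by exact_mod_cast (n - m - k).factorial_ne_zero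
  field_simp

theorem orderCoeff_zero_eq {m n k : ℕ} (hk : k ≤ n) :
    orderCoeff m n 0 k = (-1) ^ k * ((k + n).factorial /
      (k.factorial * (k + m).factorial * (n - k).factorial)) := by
  rw [orderCoeff, inv_Gamma_one_add, ascPochhammer_eval_natCast_add_one,
    ascPochhammer_eval_neg_natCast hk, add_comm n k]
  have h1 : (n.factorial : ℂ) ≠ 0 := by exact_mod_cast n.factorial_ne_zero
  have h3 : ((n - k).factorial : ℂ) ≠ 0 := by exact_mod_cast (n - k).factorial_ne_zero
  field_simp

theorem hasDerivAt_legendreP {m n : ℕ} (hmn : m ≤ n) {z : ℂ} (hz : z - 1 ∈ slitPlane) :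
    HasDerivAt (fun ν : ℂ => legendreP ν m z)
      (legendreP n m z * log ((z + 1) / 2)
        - (digamma ((n : ℂ) + m + 1) + digamma ((n : ℂ) - m + 1)) * legendreP n m z
        + ((z - 1) / 2) ^ ((m : ℂ) / 2) * ((z + 1) / 2) ^ ((m : ℂ) / 2) *
          ∑ k ∈ Finset.range (n - m + 1),
            ((k + n + m).factorial : ℂ)
                / ((k.factorial : ℂ) * (k + m).factorial * (n - m - k).factorial)
              * (2 * digamma ((k : ℂ) + n + m + 1) - digamma ((k : ℂ) + m + 1))
              * ((z - 1) / 2) ^ k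
        + ((n + m).factorial : ℂ) / (n - m).factorial
          * ((z - 1) ^ ((m : ℂ) / 2) / (z + 1) ^ ((m : ℂ) / 2)) *
          ∑ k ∈ Finset.range (n + 1),
            ((k + n).factorial : ℂ) * digamma ((k : ℂ) + m + 1)
                / ((k.factorial : ℂ) * (k + m).factorial * (n - k).factorial)
              * ((z - 1) / 2) ^ k)
      (n : ℂ) := by
  have hz1 : z - 1 ≠ 0 := slitPlane_ne_zero hz
  have hz' : z + 1 ∈ slitPlane := by
    rcases hz with h | h
    · left
      simp at h ⊢
      linarith
    · right
      simpa using h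
  have hz2 : z + 1 ≠ 0 := slitPlane_ne_zero hz'
  set w := (1 - z) / 2 with hwdef
  have hw1 : 1 - w = (z + 1) / 2 := by rw [hwdef]; ring
  have hw : w ∈ cutPlane := by
    change 1 - w ∈ slitPlane
    rw [hw1]
    rcases hz' with h | h
    · left
      simpa using h
    · right
      simpa using h
  have hneg : (z - 1) / 2 = -w := by rw [hwdef]; ring
  obtain ⟨hval, hder⟩ := gaussHG_natCast_and_hasDerivAt hmn hw
  rw [ascPochhammer_eval_shift hmn] at hval hder
  rw [deriv_diagFamily hw, deriv_orderFamily] at hder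
  have hmain := hder.const_mul ((z + 1) ^ ((m : ℂ) / 2) / (z - 1) ^ ((m : ℂ) / 2))
  refine hmain.congr_deriv ?_
  set D : ℂ := (n + m).factorial / (n - m).factorial with hD
  have hA : ∑ k ∈ Finset.range (n - m + 1),
      ((k + n + m).factorial : ℂ) / ((k.factorial : ℂ) * (k + m).factorial * (n - m - k).factorial)
        * (2 * digamma ((k : ℂ) + n + m + 1) - digamma ((k : ℂ) + m + 1)) * (-w) ^ k =
      D * ∑ k ∈ Finset.range (n - m + 1),
        diagCoeff m n 0 k * (2 * digamma (k + n + m + 1) - digamma (k + m + 1)) * w ^ k := by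
    rw [Finset.mul_sum]
    refine Finset.sum_congr rfl fun k hk => ?_
    have := factorial_mul_diagCoeff (m := m) (n := n) (k := k)
      (by have := Finset.mem_range.1 hk; omega)
    rw [neg_pow]
    linear_combination
      -((2 * digamma (k + n + m + 1) - digamma (k + m + 1)) * w ^ k) * this
  have hB : ∑ k ∈ Finset.range (n + 1),
      ((k + n).factorial : ℂ) * digamma ((k : ℂ) + m + 1)
        / ((k.factorial : ℂ) * (k + m).factorial * (n - k).factorial) * (-w) ^ k =
      ∑ k ∈ Finset.range (n + 1), orderCoeff m n 0 k * digamma (k + m + 1) * w ^ k := by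
    refine Finset.sum_congr rfl fun k hk => ?_
    rw [neg_pow, orderCoeff_zero_eq (by have := Finset.mem_range.1 hk; omega)]
    ring
  have hP : legendreP n m z =
      (z + 1) ^ ((m : ℂ) / 2) / (z - 1) ^ ((m : ℂ) / 2) * gaussHG (-n) (n + 1) (1 - m) w := rfl
  rw [div_two_cpow hz1, div_two_cpow hz2, ← hw1, hneg, hA, hB, hP, hval]
  generalize ∑ k ∈ Finset.range (n - m + 1),
    diagCoeff m n 0 k * (2 * digamma (k + n + m + 1) - digamma (k + m + 1)) * w ^ k = SA
  generalize ∑ k ∈ Finset.range (n + 1), orderCoeff m n 0 k * digamma (k + m + 1) * w ^ k = SB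
  have hu := cpow_half_natCast_sq (z + 1) m
  have hv := cpow_half_natCast_sq (z - 1) m
  have ht := cpow_half_natCast_sq 2 m
  have hu0 : (z + 1) ^ ((m : ℂ) / 2) ≠ 0 := by simp [cpow_eq_zero_iff, hz2]
  have hv0 : (z - 1) ^ ((m : ℂ) / 2) ≠ 0 := by simp [cpow_eq_zero_iff, hz1]
  have ht0 : (2 : ℂ) ^ ((m : ℂ) / 2) ≠ 0 := by simp [cpow_eq_zero_iff]
  -- These become `u ^ 2 = t ^ 2 * (1 - w) ^ m` and `v ^ 2 = t ^ 2 * ((-1) ^ m * w ^ m)`, where `u`,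
  -- `v`, `t` are the half powers of `z + 1`, `z - 1`, `2`. The bases inside `u` and `v` get
  -- rewritten too and are restored afterwards.
  rw [show z + 1 = 2 * (1 - w) by rw [hw1]; ring, mul_pow, ← ht] at hu
  rw [show z - 1 = 2 * -w by rw [← hneg]; ring, mul_pow, ← ht, neg_pow] at hv
  rw [show 2 * (1 - w) = z + 1 by rw [hw1]; ring] at hu
  rw [show 2 * -w = z - 1 by rw [← hneg]; ring] at hv
  have hw0 : (1 - w) ^ m ≠ 0 := pow_ne_zero m (slitPlane_ne_zero hw)
  generalize (z + 1) ^ ((m : ℂ) / 2) = u at *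
  generalize (z - 1) ^ ((m : ℂ) / 2) = v at *
  generalize (2 : ℂ) ^ ((m : ℂ) / 2) = t at *
  have e1 : u / v * ((-1) ^ m * w ^ m) = v / t * (u / t) := by
    have : (-1) ^ m * w ^ m = v ^ 2 / t ^ 2 := by
      rw [hv]
      field_simp
    rw [this]
    field_simp
  have e2 : u / v * ((-1) ^ m * w ^ m / (1 - w) ^ m) = v / u := by
    have : (1 - w) ^ m = u ^ 2 / t ^ 2 := by
      rw [hu]
      field_simp
    rw [← mul_div_assoc, e1, this]
    field_simp
  have e3 : u / v * ((-1) ^ m * w ^ m / (1 - w) ^ m * (1 - w) ^ m) = v / t * (u / t) := by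
    rw [div_mul_cancel₀ _ hw0, e1]
  linear_combination (D * SA) * e3 + (D * SB) * e2

theorem mainTheorem5 (n : ℕ) (z : ℂ) (hz : z - 1 ∈ Complex.slitPlane) :
    (∀ m : ℕ, m ≤ n →
      HasDerivAt (fun ν : ℂ => legendreP ν m z)
        (legendreP n m z * Complex.log ((z + 1) / 2)
          - (Complex.digamma ((n : ℂ) + m + 1) + Complex.digamma ((n : ℂ) - m + 1))
              * legendreP n m z
          + ((z - 1) / 2) ^ ((m : ℂ) / 2) * ((z + 1) / 2) ^ ((m : ℂ) / 2) *
            ∑ k ∈ Finset.range (n - m + 1),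
              ((k + n + m).factorial : ℂ)
                  / ((k.factorial : ℂ) * (k + m).factorial * (n - m - k).factorial)
                * (2 * Complex.digamma ((k : ℂ) + n + m + 1) - Complex.digamma ((k : ℂ) + m + 1))
                * ((z - 1) / 2) ^ k
          + ((n + m).factorial : ℂ) / (n - m).factorial
            * ((z - 1) ^ ((m : ℂ) / 2) / (z + 1) ^ ((m : ℂ) / 2)) *
            ∑ k ∈ Finset.range (n + 1),
              ((k + n).factorial : ℂ) * Complex.digamma ((k : ℂ) + m + 1)
                  / ((k.factorial : ℂ) * (k + m).factorial * (n - k).factorial)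
                * ((z - 1) / 2) ^ k)
        (n : ℂ)) ∧
      HasDerivAt (fun ν : ℂ => legendreP ν 0 z)
        (legendreP n 0 z * Complex.log ((z + 1) / 2)
          - 2 * Complex.digamma ((n : ℂ) + 1) * legendreP n 0 z
          + 2 * ∑ k ∈ Finset.range (n + 1),
              ((k + n).factorial : ℂ) * Complex.digamma ((k : ℂ) + n + 1)
                  / ((k.factorial : ℂ) ^ 2 * (n - k).factorial)
                * ((z - 1) / 2) ^ k)
        (n : ℂ) := by
  refine ⟨fun m hmn => hasDerivAt_legendreP hmn hz, ?_⟩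
  have h := hasDerivAt_legendreP (Nat.zero_le n) hz
  simp only [Nat.cast_zero] at h
  refine h.congr_deriv ?_
  simp only [add_zero, sub_zero, Nat.sub_zero, zero_div, cpow_zero, mul_one, div_one, one_mul]
  have hn : (n.factorial : ℂ) ≠ 0 := by exact_mod_cast n.factorial_ne_zero
  -- For `m = 0` the two sums have the same range and weights, so the `digamma (k + 1)` terms cancel
  -- and `2 * digamma (k + n + 1)` remains.
  rw [div_self hn, one_mul, add_assoc, ← Finset.sum_add_distrib, Finset.mul_sum, ← two_mul]
  congr 1
  refine Finset.sum_congr rfl fun k _ => ?_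
  ring
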